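/- Let $d\ge 1$, let $\mathcal{E}$ be the set of nearest-neighbour edges of $\mathbb{Z}^d$, and let $(t_e)_{e\in\mathcal{E}}$ be i.i.d. weights with common distribution $\mu$, a probability measure on $[0,\infty)$ with distribution function $F(x)=\mu([0,x])$. Assume that $\mu(\{0\})<p_c(d)$, where $p_c(d)$ is the critical probability of Bernoulli bond percolation on $\mathbb{Z}^d$, and that $\mathbf{E}\bigl[t_e^2\log_2^+t_e\bigr]<\infty$. For $x,y\in\mathbb{Z}^d$ let $T(x,y)=\inf_{\gamma:x\to y}\sum_{e\in\gamma}t_e$ be the passage time, the infimum being over lattice paths from $x$ to $y$; a path attaining it is called a geodesic. For $n\ge 0$ let $G_n$ be the set of edges that lie on every geodesic from $0$ to $n\mathbf{e}_1$, and let $$F_n=\frac1{\#B_m}\sum_{z\in B_m}T(z,z+n\mathbf{e}_1),\qquad m=\lceil n^{1/4}\rceil,\quad B_m=\{x\in\mathbb{Z}^d:\|x\|_1\le m\}.$$ For an enumeration $e_1,e_2,\dots$ of $\mathcal{E}$ put $\mathcal{F}_i=\sigma(t_{e_1},\dots,t_{e_i})$ (with $\mathcal{F}_0$ trivial) and $\Delta_iF_n=\mathbf{E}[F_n\mid\mathcal{F}_i]-\mathbf{E}[F_n\mid\mathcal{F}_{i-1}]$.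 For a nonnegative integrable random variable $X$ let $\mathrm{Ent}\,X=\mathbf{E}\bigl[X\log\frac{X}{\mathbf{E}X}\bigr]\in[0,\infty]$. Then $F_n$ is square integrable for every $n$, and there is a constant $C\in(0,\infty)$, depending only on $d$ and $\mu$, such that for every $n\ge 0$ and every enumeration of the edges $$\sum_{i=1}^\infty \mathrm{Ent}\bigl(|\Delta_iF_n|^2\bigr)\;\le\; C\,\mathbf{E}\sum_{e\in G_n}\bigl(1-\log F(t_e)\bigr).$$ -/

import Mathlib

open MeasureTheory ProbabilityTheory
open scoped NNReal ENNReal unitInterval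

namespace FPP

noncomputable section

/-- The graph on the points of `ℤ^d`: two points are joined when their `ℓ¹` distance is `1`,
that is, when they differ by `1` in exactly one coordinate. -/
def lattice (d : ℕ) : SimpleGraph (Fin d → ℤ) where
  Adj x y := ∑ i, |x i - y i| = 1
  symm := ⟨fun x y h => by simpa only [abs_sub_comm] using h⟩
  loopless := ⟨fun x h => by simp at h⟩

/-- The set of nearest-neighbour edges of `ℤ^d`, as a type. -/
abbrev Edge (d : ℕ) : Type := (lattice d).edgeSet

/-- A configuration: a weight in `[0,∞)` on each edge; the weight `t_e` is `ω e`. -/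
abbrev Config (d : ℕ) : Type := Edge d → ℝ≥0

/-- The law of independent weights with common distribution `μ`. -/
def weightLaw (d : ℕ) (μ : Measure ℝ≥0) [IsProbabilityMeasure μ] : Measure (Config d) :=
  Measure.infinitePi fun _ : Edge d => μ

/-- The distribution function of `μ`. -/
def distFun (μ : Measure ℝ≥0) (x : ℝ≥0) : ℝ := μ.real (Set.Iic x)

/-! Bernoulli bond percolation -/

/-- The open cluster of the origin when `S` is the set of open edges. -/
def openCluster {d : ℕ} (S : Set (Edge d)) : Set (Fin d → ℤ) :=
  {y | (SimpleGraph.fromEdgeSet (Subtype.val '' S)).Reachable 0 y}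

/-- The probability that the open cluster of the origin is infinite when every edge is open
independently with probability `p`. -/
def percolationProb (d : ℕ) (p : I) : ℝ≥0∞ :=
  setBernoulli (Set.univ : Set (Edge d)) p {S | (openCluster S).Infinite}

/-- The critical probability of Bernoulli bond percolation on `ℤ^d`. -/
def criticalProb (d : ℕ) : ℝ :=
  sSup ((fun p : I => (p : ℝ)) '' {p : I | percolationProb d p = 0})

/-! Passage times and geodesics -/

/-- The passage time `T(γ) = ∑_{e ∈ γ} t_e` of a lattice path. -/
def pathTime {d : ℕ} (ω : Config d) {x y : Fin d → ℤ} (γ : (lattice d).Walk x y) : ℝ≥0 :=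
  (γ.darts.map fun a => ω ⟨a.edge, a.edge_mem⟩).sum

/-- The passage time `T(x,y)`, the infimum of `T(γ)` over the lattice paths from `x` to `y`. -/
def passageTime {d : ℕ} (ω : Config d) (x y : Fin d → ℤ) : ℝ≥0 :=
  ⨅ γ : (lattice d).Walk x y, pathTime ω γ

/-- A geodesic is a minimizing path. -/
def IsGeodesic {d : ℕ} (ω : Config d) {x y : Fin d → ℤ} (γ : (lattice d).Walk x y) : Prop :=
  pathTime ω γ = passageTime ω x y

/-- The set of edges that lie on every geodesic from `x` to `y`. -/
def geodesicEdges {d : ℕ} (ω : Config d) (x y : Fin d → ℤ) : Set (Edge d) :=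
  {e | ∀ γ : (lattice d).Walk x y, IsGeodesic ω γ → (e : Sym2 (Fin d → ℤ)) ∈ γ.edges}

/-- The point `n e₁`. -/
def axisPoint (d : ℕ) [NeZero d] (n : ℕ) : Fin d → ℤ := Pi.single 0 (n : ℤ)

/-- The ball `B_m = {x : ‖x‖₁ ≤ m}`. -/
def ball (d m : ℕ) : Finset (Fin d → ℤ) :=
  (Finset.Icc (fun _ => -(m : ℤ)) (fun _ => (m : ℤ))).filter fun x => ∑ i, |x i| ≤ (m : ℤ)

theorem mem_ball {d m : ℕ} {x : Fin d → ℤ} : x ∈ ball d m ↔ ∑ i, |x i| ≤ (m : ℤ) := by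
  simp only [ball, Finset.mem_filter, Finset.mem_Icc, and_iff_right_iff_imp]
  intro h
  have key : ∀ i, |x i| ≤ (m : ℤ) := fun i =>
    (Finset.single_le_sum (f := fun i => |x i|) (fun j _ => abs_nonneg (x j))
      (Finset.mem_univ i)).trans h
  exact ⟨fun i => (abs_le.mp (key i)).1, fun i => (abs_le.mp (key i)).2⟩

/-- The averaged passage time `F_n = (#B_m)⁻¹ ∑_{z ∈ B_m} T(z, z + n e₁)`, `m = ⌈n^{1/4}⌉`. -/
def averagedTime (d : ℕ) [NeZero d] (n : ℕ) (ω : Config d) : ℝ :=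
  ((ball d ⌈(n : ℝ) ^ (1 / 4 : ℝ)⌉₊).card : ℝ)⁻¹ *
    ∑ z ∈ ball d ⌈(n : ℝ) ^ (1 / 4 : ℝ)⌉₊, (passageTime ω z (z + axisPoint d n) : ℝ)

/-! Martingale increments and entropy -/

/-- For an enumeration `e 0, e 1, …` of the edges, the σ-algebra generated by the weights of
the first `i` edges `e 0, …, e (i - 1)` (the trivial one for `i = 0`). -/
def edgeFiltration {d : ℕ} (e : ℕ ≃ Edge d) :
    Filtration ℕ (inferInstance : MeasurableSpace (Config d)) where
  seq i := ⨆ j : ℕ, ⨆ _ : j < i,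
    MeasurableSpace.comap (fun ω : Config d => ω (e j)) inferInstance
  mono' _ _ hik := iSup_mono fun _ => iSup_mono' fun hj => ⟨hj.trans_le hik, le_rfl⟩
  le' _ := iSup₂_le fun j _ => (measurable_pi_apply (e j)).comap_le

/-- The martingale increment contributed by the edge `e i`: conditional expectation given the
weights of `e 0, …, e i` minus conditional expectation given those of `e 0, …, e (i - 1)`. -/
def martingaleIncrement {d : ℕ} (P : Measure (Config d)) (e : ℕ ≃ Edge d) (f : Config d → ℝ)
    (i : ℕ) : Config d → ℝ :=
  P[f | edgeFiltration e (i + 1)] - P[f | edgeFiltration e i]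

/-- The entropy `E[X log (X / E X)]` of a nonnegative integrable random variable, with values in
`[0,∞]`: expectation of the positive part minus expectation of the negative part. The latter is
finite since `x log x ≥ -1/e`, and it is at most the former by the Jensen inequality, so that the
truncation in the subtraction on `[0,∞]` is never active. -/
def entropy {Ω : Type*} [MeasurableSpace Ω] (P : Measure Ω) (X : Ω → ℝ) : ℝ≥0∞ :=
  (∫⁻ ω, ENNReal.ofReal (X ω * Real.log (X ω / ∫ ω', X ω' ∂P)) ∂P) -
    ∫⁻ ω, ENNReal.ofReal (-(X ω * Real.log (X ω / ∫ ω', X ω' ∂P))) ∂P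

end

end FPP

open FPP

/-!
The proof combines a logarithmic Sobolev inequality for fair bits with the fact that the passage
time depends on a single weight only through a truncation of that weight.

*Encoding by bits.* A weight with law `μ` is written as `bitWeight μ u`, the quantile function of
`μ` at the number `bitSum u` whose binary digits are independent fair bits `u 0, u 1, …`. Functions
of the weights become functions of countably many fair bits, for which the entropy of `f ^ 2` is at
most the energy `∑ E (Δ f) ^ 2`, where `Δ f` is the change of `f` when one bit is flipped
(`entropy_sq_le_tsum_flipAt`). The energy is a quadratic form, flips commute with conditioning on
the weights of a set of edges, and martingale increments are orthogonal; hence the sum of the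
entropies of the squared increments of `F_n` is at most the energy of `F_n` itself
(`tsum_entropy_increment_le`). By convexity and translation invariance it remains to bound the
energy of `T(0, n e₁)`.

*One edge.* A shortest walk uses an edge at most once. So, as a function of the weight `t` of `e`
alone, the passage time is `c + min t D`, where the cost `D` of the detour around `e` does not
depend on `t` (`passageTime_update_eq`), and `e` lies on every geodesic as soon as `t < D`
(`mem_geodesicEdges_of_lt`). It remains to bound the energy of `min t D` by a multiple of
`E [(1 - log F (t)); t < D]`, which is at least `p (1 - log p)` with `p = μ [0, D)`
(`exists_tsum_flip_cutoff_le`).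

*The energy of a truncated weight.* Let `H ≥ 0` be nondecreasing on `[0, 1)` and `ε = 2⁻ʲ⁻¹`, so
that flipping the digit `j` of a number in `[0, 1]` adds or subtracts `ε`. As
`(a - b) ^ 2 ≤ a ^ 2 - b ^ 2` for `a ≥ b ≥ 0`, the energy in this digit is at most twice the telescoping difference of the integrals
of `H ^ 2` over `[1 - ε, 1]` and over `[0, ε]` (`lintegral_sq_flip_le`). If `D` is larger than a
median of `μ`, then `p` is bounded below, and the integrals over `[1 - ε, 1]` have a finite sum over
`j` because `t ^ 2 log⁺ t` is integrable. If `D` is smaller, the difference is at most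
`D ^ 2 min ε p`, and the sum of `min ε p` over `j` is at most `2 p (1 - log p)`.
-/

namespace FPP

open Filter Topology

/-! ### Resampling coordinates of a product measure -/

section Mix

/-- The law of a family, indexed by `ι`, of independent variables with common law `ν`. -/
noncomputable abbrev powerLaw (ι : Type*) {α : Type*} [MeasurableSpace α] (ν : Measure α)
    [IsProbabilityMeasure ν] : Measure (ι → α) :=
  Measure.infinitePi fun _ : ι => ν

section

variable {ι α : Type*}

open Classical in
/-- The family that agrees with `ω` on `S` and with `ω'` off `S`. -/
noncomputable def mix (S : Set ι) (ω ω' : ι → α) : ι → α := fun i => if i ∈ S then ω i else ω' i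

theorem mix_of_mem {S : Set ι} {ω ω' : ι → α} {i : ι} (h : i ∈ S) : mix S ω ω' i = ω i := by
  simp [mix, h]

theorem mix_of_notMem {S : Set ι} {ω ω' : ι → α} {i : ι} (h : i ∉ S) : mix S ω ω' i = ω' i := by
  simp [mix, h]

end

variable {ι α : Type*} [MeasurableSpace α]

theorem measurable_mix (S : Set ι) :
    Measurable fun p : (ι → α) × (ι → α) => mix S p.1 p.2 := by
  refine measurable_pi_lambda _ fun i => ?_
  by_cases h : i ∈ S
  · simp only [mix_of_mem h]; fun_prop
  · simp only [mix_of_notMem h]; fun_prop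

variable (ν : Measure α) [IsProbabilityMeasure ν]

/-- Resampling the coordinates off `S` does not change the law of an independent family. -/
theorem measurePreserving_mix (S : Set ι) :
    MeasurePreserving (fun p : (ι → α) × (ι → α) => mix S p.1 p.2)
      ((powerLaw ι ν).prod (powerLaw ι ν)) (powerLaw ι ν) := by
  classical
  refine ⟨measurable_mix S, Measure.eq_infinitePi _ fun s t ht => ?_⟩
  rw [Measure.map_apply (measurable_mix S) (.pi s.countable_toSet fun i _ => ht i)]
  have : (fun p : (ι → α) × (ι → α) => mix S p.1 p.2) ⁻¹' ((s : Set ι).pi t) =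
      (((s.filter (· ∈ S) : Finset ι) : Set ι).pi t) ×ˢ
        (((s.filter (· ∉ S) : Finset ι) : Set ι).pi t) := by
    ext p
    simp only [Set.mem_preimage, Set.mem_pi, Finset.mem_coe, Set.mem_prod, Finset.mem_filter]
    refine ⟨fun h => ⟨fun i hi => ?_, fun i hi => ?_⟩, fun h i hi => ?_⟩
    · simpa [mix_of_mem hi.2] using h i hi.1
    · simpa [mix_of_notMem hi.2] using h i hi.1
    · by_cases hS : i ∈ S
      · simpa [mix_of_mem hS] using h.1 i ⟨hi, hS⟩
      · simpa [mix_of_notMem hS] using h.2 i ⟨hi, hS⟩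
  rw [this, Measure.prod_prod, Measure.infinitePi_pi _ fun i _ => ht i,
    Measure.infinitePi_pi _ fun i _ => ht i, Finset.prod_filter_mul_prod_filter_not]

/-- The average of `f` over the coordinates off `S`: a version of the conditional expectation
of `f` given the coordinates in `S`. -/
noncomputable def avgOff (S : Set ι) (f : (ι → α) → ℝ) (ω : ι → α) : ℝ :=
  ∫ ω', f (mix S ω ω') ∂(powerLaw ι ν)

/-- The σ-algebra generated by the coordinates in `S`. -/
abbrev coordAlgebra (α : Type*) [MeasurableSpace α] (S : Set ι) : MeasurableSpace (ι → α) :=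
  MeasurableSpace.comap (S.domRestrict (π := fun _ => α)) inferInstance

theorem coordAlgebra_le (S : Set ι) :
    coordAlgebra α S ≤ (inferInstance : MeasurableSpace (ι → α)) :=
  Measurable.comap_le (by fun_prop)

theorem coordAlgebra_eq_iSup (S : Set ι) :
    coordAlgebra α S = ⨆ i ∈ S, MeasurableSpace.comap (fun ω : ι → α => ω i) inferInstance := by
  simp only [coordAlgebra, MeasurableSpace.pi, MeasurableSpace.comap_iSup,
    MeasurableSpace.comap_comp]
  rw [iSup_subtype]
  rfl

/-- Events that depend only on the coordinates in `S` are not affected by resampling the others. -/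
theorem mix_mem_iff {S : Set ι} {A : Set (ι → α)} (hA : MeasurableSet[coordAlgebra α S] A)
    (ω ω' : ι → α) : mix S ω ω' ∈ A ↔ ω ∈ A := by
  obtain ⟨B, -, rfl⟩ := hA
  have : S.domRestrict (mix S ω ω') = S.domRestrict ω := by
    ext i
    simp [mix_of_mem i.2]
  simp [this]

variable {ν}

theorem integrable_comp_mix {S : Set ι} {f : (ι → α) → ℝ} (hf : Integrable f (powerLaw ι ν)) :
    Integrable (fun p : (ι → α) × (ι → α) => f (mix S p.1 p.2))
      ((powerLaw ι ν).prod (powerLaw ι ν)) :=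
  (measurePreserving_mix ν S).integrable_comp_of_integrable hf

theorem stronglyMeasurable_avgOff {S : Set ι} {f : (ι → α) → ℝ} (hf : Measurable f) :
    StronglyMeasurable[coordAlgebra α S] (avgOff ν S f) := by
  have h : @Measurable _ _ (@Prod.instMeasurableSpace _ _ (coordAlgebra α S) _) _
      fun p : (ι → α) × (ι → α) => mix S p.1 p.2 := by
    refine @measurable_pi_lambda _ _ _ (@Prod.instMeasurableSpace _ _ (coordAlgebra α S) _) _ _
      fun i => ?_
    by_cases hi : i ∈ S
    · simp only [mix_of_mem hi]
      have h1 : Measurable[coordAlgebra α S] fun ω : ι → α => ω i := by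
        rw [coordAlgebra_eq_iSup]
        exact Measurable.mono (comap_measurable _) (le_iSup₂_of_le i hi le_rfl) le_rfl
      exact h1.comp (@measurable_fst _ _ (coordAlgebra α S) _)
    · simp only [mix_of_notMem hi]
      exact (measurable_pi_apply i).comp (@measurable_snd _ _ (coordAlgebra α S) _)
  exact @MeasureTheory.StronglyMeasurable.integral_prod_right' (ι → α) (ι → α) ℝ
    (coordAlgebra α S) _ (powerLaw ι ν) _ _ _ _ (hf.comp h).stronglyMeasurable

theorem measurable_avgOff {S : Set ι} {f : (ι → α) → ℝ} (hf : Measurable f) :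
    Measurable (avgOff ν S f) :=
  ((stronglyMeasurable_avgOff hf).mono (coordAlgebra_le S)).measurable

theorem avgOff_ae_eq_condExp {S : Set ι} {f : (ι → α) → ℝ} (hf : Measurable f)
    (hfi : Integrable f (powerLaw ι ν)) :
    avgOff ν S f =ᵐ[powerLaw ι ν] (powerLaw ι ν)[f | coordAlgebra α S] := by
  refine ae_eq_condExp_of_forall_setIntegral_eq (coordAlgebra_le S) hfi
    (fun s _ _ => ((integrable_comp_mix (S := S) hfi).integral_prod_left).integrableOn)
    (fun A hA _ => ?_) (stronglyMeasurable_avgOff hf).aestronglyMeasurable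
  have hA' := coordAlgebra_le S A hA
  rw [← integral_indicator hA', ← integral_indicator hA']
  have hm := measurePreserving_mix ν S
  have h1 : Integrable (A.indicator f) (powerLaw ι ν) := hfi.indicator hA'
  have h2 : ∫ ω, A.indicator f ω ∂(powerLaw ι ν) =
      ∫ p, A.indicator f (mix S p.1 p.2) ∂((powerLaw ι ν).prod (powerLaw ι ν)) := by
    conv_lhs => rw [← hm.map_eq]
    rw [integral_map hm.measurable.aemeasurable (by
      rw [hm.map_eq]; exact h1.aestronglyMeasurable)]
  rw [h2, integral_prod _ (integrable_comp_mix h1)]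
  refine integral_congr_ae (.of_forall fun ω => ?_)
  by_cases hω : ω ∈ A
  · simp [Set.indicator, hω, avgOff, mix_mem_iff hA]
  · simp [Set.indicator, hω, mix_mem_iff hA]

theorem measurePreserving_update_self [DecidableEq ι] {τ : α → α} (hτ : MeasurePreserving τ ν ν)
    (i : ι) :
    MeasurePreserving (fun ω : ι → α => Function.update ω i (τ (ω i)))
      (powerLaw ι ν) (powerLaw ι ν) := by
  have h := Measure.infinitePi_map_pi (fun _ : ι => ν) (f := fun j => if j = i then τ else id)
    (fun j => by split_ifs; exacts [hτ.measurable, measurable_id])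
  have e1 : (fun (x : ι → α) j => (if j = i then τ else id) (x j)) =
      fun ω : ι → α => Function.update ω i (τ (ω i)) := by
    ext x j
    by_cases hj : j = i
    · subst hj; simp
    · simp [hj]
  have e2 : ∀ j, Measure.map (if j = i then τ else id) ν = ν := fun j => by
    split_ifs
    exacts [hτ.map_eq, Measure.map_id]
  refine ⟨?_, ?_⟩
  · refine measurable_pi_lambda _ fun j => ?_
    by_cases hj : j = i
    · subst hj; simpa [Function.comp_def] using hτ.measurable.comp (measurable_pi_apply j)
    · simpa [hj] using measurable_pi_apply j
  · rw [← e1, h]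
    congr 1
    exact funext e2

/-- Averaging over some coordinates commutes with a measure preserving transformation of a
single coordinate. -/
theorem avgOff_comp_update [DecidableEq ι] {S : Set ι} {f : (ι → α) → ℝ} (hf : Measurable f)
    {τ : α → α} (hτ : MeasurePreserving τ ν ν) (i : ι) (ω : ι → α) :
    avgOff ν S (fun ω => f (Function.update ω i (τ (ω i)))) ω =
      avgOff ν S f (Function.update ω i (τ (ω i))) := by
  unfold avgOff
  by_cases hi : i ∈ S
  · refine integral_congr_ae (.of_forall fun ω' => congrArg f (funext fun j => ?_))
    by_cases hj : j = i
    · subst hj; simp [mix_of_mem hi]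
    · by_cases hS : j ∈ S <;> simp [hj, mix, hS]
  · have hmp := measurePreserving_update_self hτ i
    have hm : Measurable fun ω' => f (mix S (Function.update ω i (τ (ω i))) ω') :=
      hf.comp ((measurable_mix S).comp (measurable_const.prodMk measurable_id))
    conv_rhs => rw [← hmp.map_eq]
    rw [integral_map hmp.measurable.aemeasurable hm.aestronglyMeasurable]
    refine integral_congr_ae (.of_forall fun ω' => congrArg f (funext fun j => ?_))
    by_cases hj : j = i
    · subst hj; simp [mix_of_notMem hi]
    · by_cases hS : j ∈ S <;> simp [hj, mix, hS]

/-- The first `k` indices in the enumeration `e`. -/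
def firstCoords (e : ℕ ≃ ι) (k : ℕ) : Set ι := {i | e.symm i < k}

theorem firstCoords_mono (e : ℕ ≃ ι) : Monotone (firstCoords e) :=
  fun _ _ hkl i hi => lt_of_lt_of_le (show e.symm i < _ from hi) hkl

theorem coordAlgebra_mono {S T : Set ι} (h : S ⊆ T) : coordAlgebra α S ≤ coordAlgebra α T := by
  rw [coordAlgebra_eq_iSup, coordAlgebra_eq_iSup]
  exact iSup_mono fun i => iSup_mono' fun hi => ⟨h hi, le_rfl⟩

/-- The filtration generated by revealing the coordinates one by one. -/
def coordFiltration (α : Type*) [MeasurableSpace α] (e : ℕ ≃ ι) :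
    Filtration ℕ (inferInstance : MeasurableSpace (ι → α)) where
  seq k := coordAlgebra α (firstCoords e k)
  mono' _ _ hkl := coordAlgebra_mono (firstCoords_mono e hkl)
  le' _ := coordAlgebra_le _

theorem iSup_coordFiltration (e : ℕ ≃ ι) :
    ⨆ k, coordFiltration α e k = (inferInstance : MeasurableSpace (ι → α)) := by
  refine le_antisymm (iSup_le fun k => (coordFiltration α e).le k) ?_
  refine iSup_le fun i => le_iSup_of_le (e.symm i + 1) ?_
  change _ ≤ coordAlgebra α _
  rw [coordAlgebra_eq_iSup]
  exact le_iSup₂_of_le i (Nat.lt_succ_self _) le_rfl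

theorem memLp_avgOff {S : Set ι} {f : (ι → α) → ℝ} (hf : Measurable f)
    (hf2 : MemLp f 2 (powerLaw ι ν)) : MemLp (avgOff ν S f) 2 (powerLaw ι ν) :=
  (hf2.condExp one_le_two).ae_eq (avgOff_ae_eq_condExp hf (hf2.integrable one_le_two)).symm

theorem avgOff_sub_ae {S : Set ι} {f g : (ι → α) → ℝ} (hf : Measurable f) (hg : Measurable g)
    (hfi : Integrable f (powerLaw ι ν)) (hgi : Integrable g (powerLaw ι ν)) :
    avgOff ν S (f - g) =ᵐ[powerLaw ι ν] avgOff ν S f - avgOff ν S g :=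
  (avgOff_ae_eq_condExp (hf.sub hg) (hfi.sub hgi)).trans ((condExp_sub hfi hgi _).trans
    ((avgOff_ae_eq_condExp hf hfi).sub (avgOff_ae_eq_condExp hg hgi)).symm)

theorem variance_avgOff_le {S : Set ι} {f : (ι → α) → ℝ} (hf : Measurable f)
    (hf2 : MemLp f 2 (powerLaw ι ν)) :
    Var[avgOff ν S f; powerLaw ι ν] ≤ Var[f; powerLaw ι ν] := by
  rw [variance_congr (avgOff_ae_eq_condExp hf (hf2.integrable one_le_two)),
    ← integral_condVar_add_variance_condExp (coordAlgebra_le S) hf2]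
  refine le_add_of_nonneg_left (integral_nonneg_of_ae ?_)
  exact condExp_nonneg (.of_forall fun _ => sq_nonneg _)

/-- The law of total variance for two nested sets of coordinates. -/
theorem integral_sq_avgOff_sub {S T : Set ι} (hST : S ⊆ T) {f : (ι → α) → ℝ} (hf : Measurable f)
    (hf2 : MemLp f 2 (powerLaw ι ν)) :
    ∫ ω, (avgOff ν T f ω - avgOff ν S f ω) ^ 2 ∂(powerLaw ι ν) =
      Var[avgOff ν T f; powerLaw ι ν] - Var[avgOff ν S f; powerLaw ι ν] := by
  have hfi := hf2.integrable one_le_two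
  have hT := memLp_avgOff (S := T) hf hf2
  have h1 : (powerLaw ι ν)[avgOff ν T f | coordAlgebra α S] =ᵐ[powerLaw ι ν] avgOff ν S f :=
    (condExp_congr_ae (avgOff_ae_eq_condExp hf hfi)).trans
      ((condExp_condExp_of_le (coordAlgebra_mono hST) (coordAlgebra_le T)).trans
        (avgOff_ae_eq_condExp hf hfi).symm)
  rw [← integral_condVar_add_variance_condExp (coordAlgebra_le S) hT, variance_congr h1,
    add_sub_cancel_right, condVar, integral_condExp (coordAlgebra_le S)]
  refine integral_congr_ae ?_
  filter_upwards [h1] with ω hω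
  simp [hω]

theorem lintegral_ofReal_sq {Ω : Type*} [MeasurableSpace Ω] {P : Measure Ω} {f : Ω → ℝ}
    (hf : MemLp f 2 P) :
    ∫⁻ ω, ENNReal.ofReal (f ω ^ 2) ∂P = ENNReal.ofReal (∫ ω, f ω ^ 2 ∂P) :=
  (ofReal_integral_eq_lintegral_ofReal hf.integrable_sq (.of_forall fun _ => sq_nonneg _)).symm

/-- The martingale increments of a square integrable function are orthogonal, so their squared
norms add up to at most the squared norm of the function. -/
theorem tsum_lintegral_sq_increment_le (e : ℕ ≃ ι) {f : (ι → α) → ℝ} (hf : Measurable f)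
    (hf2 : MemLp f 2 (powerLaw ι ν)) :
    ∑' k, ∫⁻ ω, ENNReal.ofReal ((avgOff ν (firstCoords e (k + 1)) f ω -
        avgOff ν (firstCoords e k) f ω) ^ 2) ∂(powerLaw ι ν) ≤
      ∫⁻ ω, ENNReal.ofReal (f ω ^ 2) ∂(powerLaw ι ν) := by
  refine ENNReal.tsum_le_of_sum_range_le fun N => ?_
  have h2 : ∀ k, MemLp (avgOff ν (firstCoords e k) f) 2 (powerLaw ι ν) :=
    fun k => memLp_avgOff hf hf2
  have key : ∀ k, ∫⁻ ω, ENNReal.ofReal ((avgOff ν (firstCoords e (k + 1)) f ω -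
        avgOff ν (firstCoords e k) f ω) ^ 2) ∂(powerLaw ι ν) =
      ENNReal.ofReal (∫ ω, (avgOff ν (firstCoords e (k + 1)) f ω -
        avgOff ν (firstCoords e k) f ω) ^ 2 ∂(powerLaw ι ν)) :=
    fun k => lintegral_ofReal_sq ((h2 (k + 1)).sub (h2 k))
  simp only [key]
  rw [lintegral_ofReal_sq hf2, ← ENNReal.ofReal_sum_of_nonneg
    fun k _ => integral_nonneg fun _ => sq_nonneg _]
  refine ENNReal.ofReal_le_ofReal ?_
  simp only [integral_sq_avgOff_sub (firstCoords_mono e (Nat.le_succ _)) hf hf2]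
  rw [Finset.sum_range_sub (fun k => Var[avgOff ν (firstCoords e k) f; powerLaw ι ν])]
  calc _ ≤ Var[avgOff ν (firstCoords e N) f; powerLaw ι ν] :=
        sub_le_self _ (variance_nonneg _ _)
    _ ≤ Var[f; powerLaw ι ν] := variance_avgOff_le hf hf2
    _ ≤ _ := variance_le_expectation_sq hf.aestronglyMeasurable

end Mix

/-! ### The logarithmic Sobolev inequality for finitely many fair bits -/

section Update

variable {ι α : Type*} [MeasurableSpace α] [DecidableEq ι] (ν : Measure α) [IsProbabilityMeasure ν]

/-- Resampling a single coordinate does not change the law of an independent family. -/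
theorem measurePreserving_update (i : ι) :
    MeasurePreserving (fun p : (ι → α) × α => Function.update p.1 i p.2)
      ((powerLaw ι ν).prod ν) (powerLaw ι ν) := by
  have hm : Measurable fun p : (ι → α) × α => Function.update p.1 i p.2 := by
    refine measurable_pi_lambda _ fun j => ?_
    by_cases hj : j = i
    · subst hj; simpa using measurable_snd
    · simp only [Function.update_of_ne hj]; fun_prop
  refine ⟨hm, ?_⟩
  have h1 := (MeasurePreserving.id (powerLaw ι ν)).prod
    (measurePreserving_eval_infinitePi (fun _ : ι => ν) i)
  refine Eq.trans ?_ (measurePreserving_mix ν ({i}ᶜ : Set ι)).map_eq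
  rw [← h1.map_eq, Measure.map_map hm h1.measurable]
  congr 1
  ext p j
  by_cases hj : j = i
  · subst hj; simp [mix]
  · simp [mix, hj]

end Update

section Coin

/-- The law of a fair coin. -/
noncomputable def coin : Measure Bool :=
  (2⁻¹ : ℝ≥0∞) • Measure.dirac false + (2⁻¹ : ℝ≥0∞) • Measure.dirac true

instance : IsProbabilityMeasure coin := ⟨by simp [coin, ENNReal.inv_two_add_inv_two]⟩

theorem measurePreserving_not : MeasurePreserving Bool.not coin coin := by
  refine ⟨measurable_from_top, ?_⟩
  rw [coin, Measure.map_add _ _ measurable_from_top, Measure.map_smul, Measure.map_smul,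
    Measure.map_dirac' measurable_from_top, Measure.map_dirac' measurable_from_top, add_comm]
  rfl

theorem integral_coin (f : Bool → ℝ) : ∫ b, f b ∂coin = (f false + f true) / 2 := by
  rw [coin, integral_add_measure, integral_smul_measure, integral_smul_measure, integral_dirac,
    integral_dirac]
  · simp; ring
  · exact (integrable_dirac (by simp)).smul_measure (by simp)
  · exact (integrable_dirac (by simp)).smul_measure (by simp)

theorem lintegral_coin (f : Bool → ℝ≥0∞) : ∫⁻ b, f b ∂coin = 2⁻¹ * (f false + f true) := by
  simp [coin, lintegral_add_measure, lintegral_smul_measure, mul_add]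

variable {ι : Type*} [DecidableEq ι]

/-- The family of bits with the bit `i` flipped. -/
def flipAt (i : ι) (ω : ι → Bool) : ι → Bool := Function.update ω i (!ω i)

theorem measurePreserving_flipAt (i : ι) :
    MeasurePreserving (flipAt i) (powerLaw ι coin) (powerLaw ι coin) :=
  measurePreserving_update_self measurePreserving_not i

theorem integral_update_coin (i : ι) {f : (ι → Bool) → ℝ} (hf : Integrable f (powerLaw ι coin)) :
    ∫ ω, f ω ∂(powerLaw ι coin) =
      ∫ ω, (f (Function.update ω i false) + f (Function.update ω i true)) / 2
        ∂(powerLaw ι coin) := by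
  have h := measurePreserving_update coin i
  have hi : Integrable (fun p : (ι → Bool) × Bool => f (Function.update p.1 i p.2))
      ((powerLaw ι coin).prod coin) := h.integrable_comp_of_integrable hf
  conv_lhs => rw [← h.map_eq]
  rw [integral_map h.measurable.aemeasurable (by rw [h.map_eq]; exact hf.aestronglyMeasurable),
    integral_prod _ hi]
  simp only [integral_coin]

theorem lintegral_update_coin (i : ι) {f : (ι → Bool) → ℝ≥0∞} (hf : Measurable f) :
    ∫⁻ ω, f ω ∂(powerLaw ι coin) =
      ∫⁻ ω, 2⁻¹ * (f (Function.update ω i false) + f (Function.update ω i true))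
        ∂(powerLaw ι coin) := by
  have h := measurePreserving_update coin i
  rw [← h.lintegral_comp hf, lintegral_prod
    (fun p : (ι → Bool) × Bool => f (Function.update p.1 i p.2))
    (hf.comp h.measurable).aemeasurable]
  simp only [lintegral_coin]

end Coin

section TwoPoint

/-- A bound for the entropy of a variable with two equally likely values, from the comparison of
its entropy with the ratio of its variance to its mean. -/
theorem two_point_entropy_le {A B K : ℝ} (hA : 0 ≤ A) (hB : 0 ≤ B)
    (h : (A - B) ^ 2 ≤ K * (2 * (A + B))) (hK : 0 ≤ K) :
    (A * Real.log A + B * Real.log B) / 2 - (A + B) / 2 * Real.log ((A + B) / 2) ≤ K := by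
  rcases (add_nonneg hA hB).eq_or_lt with h0 | h0
  · obtain rfl : A = 0 := by linarith
    obtain rfl : B = 0 := by linarith
    simpa using hK
  set m := (A + B) / 2 with hm
  have hm0 : 0 < m := by positivity
  have key : ∀ x : ℝ, 0 ≤ x → x * Real.log x - x * Real.log m ≤ x * (x / m - 1) := by
    intro x hx
    rcases hx.eq_or_lt with rfl | hx
    · simp
    · rw [← mul_sub, ← Real.log_div hx.ne' hm0.ne']
      exact mul_le_mul_of_nonneg_left (Real.log_le_sub_one_of_pos (by positivity)) hx.le
  have h1 := key A hA
  have h2 := key B hB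
  have h3 : (A * (A / m - 1) + B * (B / m - 1)) / 2 ≤ K := by
    have : (A * (A / m - 1) + B * (B / m - 1)) / 2 = (A - B) ^ 2 / (2 * (A + B)) := by
      rw [hm]; field_simp; ring
    rw [this, div_le_iff₀ (by positivity)]
    exact h
  have h4 : (A + B) / 2 * Real.log m = (A * Real.log m + B * Real.log m) / 2 := by ring
  rw [← hm] at h4
  linarith

/-- The Cauchy–Schwarz inequality, from the sign of a discriminant. -/
theorem integral_mul_sq_le {Ω : Type*} [MeasurableSpace Ω] {P : Measure Ω} {f g : Ω → ℝ}
    (hf : MemLp f 2 P) (hg : MemLp g 2 P) :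
    (∫ ω, f ω * g ω ∂P) ^ 2 ≤ (∫ ω, f ω ^ 2 ∂P) * ∫ ω, g ω ^ 2 ∂P := by
  have hfg : Integrable (fun ω => f ω * g ω) P := hf.integrable_mul hg
  have h : ∀ t : ℝ, 0 ≤ (∫ ω, f ω ^ 2 ∂P) * (t * t) + (2 * ∫ ω, f ω * g ω ∂P) * t +
      ∫ ω, g ω ^ 2 ∂P := by
    intro t
    have : (∫ ω, f ω ^ 2 ∂P) * (t * t) + (2 * ∫ ω, f ω * g ω ∂P) * t + ∫ ω, g ω ^ 2 ∂P =
        ∫ ω, (f ω * t + g ω) ^ 2 ∂P := by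
      have e : ∀ ω, (f ω * t + g ω) ^ 2 = (t * t) * f ω ^ 2 + (2 * t) * (f ω * g ω) + g ω ^ 2 :=
        fun ω => by ring
      simp only [e]
      rw [integral_add, integral_add, integral_const_mul, integral_const_mul]
      · ring
      · exact hf.integrable_sq.const_mul _
      · exact hfg.const_mul _
      · exact (hf.integrable_sq.const_mul _).add (hfg.const_mul _)
      · exact hg.integrable_sq
    rw [this]
    exact integral_nonneg fun _ => sq_nonneg _
  have := discrim_le_zero h
  rw [discrim] at this
  linarith

end TwoPoint

section FiniteLSI

variable {ι : Type*}

theorem _root_.DependsOn.measurable_of_finset {s : Finset ι} {f : (ι → Bool) → ℝ}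
    (h : DependsOn f (s : Set ι)) : Measurable f := by
  obtain ⟨g, rfl⟩ := (dependsOn_iff_exists_comp).1 h
  exact (measurable_of_finite g).comp (by fun_prop)

theorem _root_.DependsOn.memLp_of_finset {s : Finset ι} {f : (ι → Bool) → ℝ}
    (h : DependsOn f (s : Set ι)) (p : ℝ≥0∞) : MemLp f p (powerLaw ι coin) := by
  have hm := h.measurable_of_finset
  obtain ⟨g, rfl⟩ := (dependsOn_iff_exists_comp).1 h
  obtain ⟨C, hC⟩ := (Set.finite_range fun x => ‖g x‖).bddAbove
  exact MemLp.of_bound hm.aestronglyMeasurable C (.of_forall fun ω => hC ⟨_, rfl⟩)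

theorem _root_.DependsOn.integrable_of_finset {s : Finset ι} {f : (ι → Bool) → ℝ}
    (h : DependsOn f (s : Set ι)) : Integrable f (powerLaw ι coin) :=
  memLp_one_iff_integrable.1 (h.memLp_of_finset 1)

variable [DecidableEq ι]

theorem flipAt_update {i j : ι} (h : j ≠ i) (ω : ι → Bool) (b : Bool) :
    flipAt j (Function.update ω i b) = Function.update (flipAt j ω) i b := by
  rw [flipAt, flipAt, Function.update_of_ne h, Function.update_comm h]

theorem _root_.DependsOn.comp_update {s : Finset ι} {i : ι} {f : (ι → Bool) → ℝ}
    (h : DependsOn f ((insert i s : Finset ι) : Set ι)) (b : Bool) :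
    DependsOn (fun ω => f (Function.update ω i b)) (s : Set ι) := by
  intro x y hxy
  refine h fun j hj => ?_
  by_cases hji : j = i
  · subst hji; simp
  · simp only [Finset.coe_insert, Set.mem_insert_iff, hji, false_or] at hj
    simpa [hji] using hxy j hj

theorem _root_.DependsOn.comp_flipAt {s : Finset ι} {f : (ι → Bool) → ℝ}
    (h : DependsOn f (s : Set ι)) (i : ι) : DependsOn (fun ω => f (flipAt i ω)) (s : Set ι) := by
  intro x y hxy
  refine h fun j hj => ?_
  by_cases hji : j = i
  · subst hji; simp [flipAt, hxy j hj]
  · simpa [flipAt, hji] using hxy j hj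

/-- The logarithmic Sobolev inequality for functions of finitely many fair bits. -/
theorem integral_mul_log_sub_le_of_dependsOn (s : Finset ι) (f : (ι → Bool) → ℝ)
    (hf : DependsOn f (s : Set ι)) :
    ∫ ω, f ω ^ 2 * Real.log (f ω ^ 2) ∂(powerLaw ι coin) -
        (∫ ω, f ω ^ 2 ∂(powerLaw ι coin)) * Real.log (∫ ω, f ω ^ 2 ∂(powerLaw ι coin)) ≤
      ∑ i ∈ s, ∫ ω, (f ω - f (flipAt i ω)) ^ 2 ∂(powerLaw ι coin) := by
  induction s using Finset.induction_on generalizing f with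
  | empty =>
    have : ∀ ω, f ω = f fun _ => false := fun ω => hf (by simp)
    simp only [this]
    simp
  | insert i s hi ih =>
    set P := powerLaw ι coin
    -- the two restrictions of `f` obtained by fixing the bit `i`
    set g : Bool → (ι → Bool) → ℝ := fun b ω => f (Function.update ω i b) with hg
    have hgd : ∀ b, DependsOn (g b) (s : Set ι) := fun b => hf.comp_update b
    have hint : ∀ b, ∀ F : ℝ → ℝ, Integrable (fun ω => F (g b ω)) P := fun b F =>
      DependsOn.integrable_of_finset (s := s) fun x y h => congrArg F (hgd b h)
    have hsplit : ∀ F : ℝ → ℝ, ∫ ω, F (f ω) ∂P =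
        (∫ ω, F (g false ω) ∂P + ∫ ω, F (g true ω) ∂P) / 2 := by
      intro F
      rw [integral_update_coin i (DependsOn.integrable_of_finset (s := insert i s)
        fun x y h => congrArg F (hf h)), integral_div, integral_add (hint _ F) (hint _ F)]
    have hflip : ∀ j ∈ s, ∫ ω, (f ω - f (flipAt j ω)) ^ 2 ∂P =
        (∫ ω, (g false ω - g false (flipAt j ω)) ^ 2 ∂P +
          ∫ ω, (g true ω - g true (flipAt j ω)) ^ 2 ∂P) / 2 := by
      intro j hj
      have hji : j ≠ i := fun h => hi (h ▸ hj)
      have hd : ∀ {t : Finset ι} {k : (ι → Bool) → ℝ}, DependsOn k (t : Set ι) →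
          DependsOn (fun ω => (k ω - k (flipAt j ω)) ^ 2) (t : Set ι) :=
        fun {t k} hk x y h => by
          have h1 := hk h
          have h2 : k (flipAt j x) = k (flipAt j y) := hk.comp_flipAt j h
          simp only [h1, h2]
      rw [integral_update_coin i (hd hf).integrable_of_finset, integral_div]
      simp only [flipAt_update hji]
      rw [integral_add (hd (hgd false)).integrable_of_finset (hd (hgd true)).integrable_of_finset]
    have hflip_i : ∫ ω, (f ω - f (flipAt i ω)) ^ 2 ∂P = ∫ ω, (g false ω - g true ω) ^ 2 ∂P := by
      have hd : DependsOn (fun ω => (f ω - f (flipAt i ω)) ^ 2) ((insert i s : Finset ι) : Set ι) :=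
        fun x y h => by
          have h1 := hf h
          have h2 : f (flipAt i x) = f (flipAt i y) := hf.comp_flipAt i h
          simp only [h1, h2]
      rw [integral_update_coin i hd.integrable_of_finset]
      refine integral_congr_ae (.of_forall fun ω => ?_)
      simp only [flipAt, Function.update_idem, Function.update_self, hg, Bool.not_false,
        Bool.not_true]
      ring
    rw [Finset.sum_insert hi, hflip_i, hsplit fun x => x ^ 2 * Real.log (x ^ 2),
      hsplit fun x => x ^ 2, Finset.sum_congr rfl hflip, ← Finset.sum_div,
      Finset.sum_add_distrib]
    have h0 := ih _ (hgd false)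
    have h1 := ih _ (hgd true)
    have hL2 : ∀ b, MemLp (g b) 2 P := fun b => (hgd b).memLp_of_finset 2
    have h2 := two_point_entropy_le (A := ∫ ω, g false ω ^ 2 ∂P) (B := ∫ ω, g true ω ^ 2 ∂P)
      (K := ∫ ω, (g false ω - g true ω) ^ 2 ∂P)
      (integral_nonneg fun _ => sq_nonneg _) (integral_nonneg fun _ => sq_nonneg _) (by
        have e1 : ∫ ω, g false ω ^ 2 ∂P - ∫ ω, g true ω ^ 2 ∂P =
            ∫ ω, (g false ω - g true ω) * (g false ω + g true ω) ∂P := by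
          rw [← integral_sub (hL2 _).integrable_sq (hL2 _).integrable_sq]
          congr 1; ext ω; ring
        have e2 : ∫ ω, (g false ω + g true ω) ^ 2 ∂P ≤
            2 * (∫ ω, g false ω ^ 2 ∂P + ∫ ω, g true ω ^ 2 ∂P) := by
          rw [← integral_add (hL2 _).integrable_sq (hL2 _).integrable_sq, ← integral_const_mul]
          refine integral_mono ((hL2 _).add (hL2 _)).integrable_sq
            (((hL2 _).integrable_sq.add (hL2 _).integrable_sq).const_mul _) fun ω => ?_
          simp only
          nlinarith [sq_nonneg (g false ω - g true ω)]
        rw [e1]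
        exact (integral_mul_sq_le ((hL2 _).sub (hL2 _)) ((hL2 _).add (hL2 _))).trans
          (mul_le_mul_of_nonneg_left e2 (integral_nonneg fun _ => sq_nonneg _)))
      (integral_nonneg fun _ => sq_nonneg _)
    linarith

end FiniteLSI

/-! ### Entropy and the logarithmic Sobolev inequality for countably many fair bits -/

section Entropy

theorem neg_one_le_mul_log {x : ℝ} (hx : 0 ≤ x) : -1 ≤ x * Real.log x := by
  rcases hx.eq_or_lt with rfl | hx
  · simp
  · have h := mul_le_mul_of_nonneg_left (Real.one_sub_inv_le_log_of_pos hx) hx.le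
    have : x * (1 - x⁻¹) = x - 1 := by field_simp
    linarith

theorem entropy_le_ofReal {Ω : Type*} [MeasurableSpace Ω] {P : Measure Ω} {X : Ω → ℝ}
    (hXi : Integrable X P)
    (hXl : Integrable (fun ω => X ω * Real.log (X ω)) P) :
    entropy P X ≤ ENNReal.ofReal
      (∫ ω, X ω * Real.log (X ω) ∂P - (∫ ω, X ω ∂P) * Real.log (∫ ω, X ω ∂P)) := by
  rw [entropy]
  set m := ∫ ω, X ω ∂P with hm
  by_cases hm0 : m = 0
  · simp [hm0]
  have e : ∀ ω, X ω * Real.log (X ω / m) = X ω * Real.log (X ω) - X ω * Real.log m := by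
    intro ω
    rcases eq_or_ne (X ω) 0 with h | h
    · simp [h]
    · rw [Real.log_div h hm0, mul_sub]
  simp only [e]
  have hi : Integrable (fun ω => X ω * Real.log (X ω) - X ω * Real.log m) P :=
    hXl.sub (hXi.mul_const _)
  have hI : ∫ ω, X ω * Real.log (X ω) ∂P - m * Real.log m =
      ∫ ω, (X ω * Real.log (X ω) - X ω * Real.log m) ∂P := by
    rw [integral_sub hXl (hXi.mul_const _), integral_mul_const]
  have hfin : ∫⁻ ω, ENNReal.ofReal (X ω * Real.log (X ω) - X ω * Real.log m) ∂P ≠ ∞ :=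
    hi.lintegral_lt_top.ne
  have hfin' : ∫⁻ ω, ENNReal.ofReal (-(X ω * Real.log (X ω) - X ω * Real.log m)) ∂P ≠ ∞ :=
    hi.neg.lintegral_lt_top.ne
  rw [hI, integral_eq_lintegral_pos_part_sub_lintegral_neg_part hi, tsub_le_iff_right]
  set a := ∫⁻ ω, ENNReal.ofReal (X ω * Real.log (X ω) - X ω * Real.log m) ∂P
  set b := ∫⁻ ω, ENNReal.ofReal (-(X ω * Real.log (X ω) - X ω * Real.log m)) ∂P
  rw [ENNReal.ofReal_sub _ ENNReal.toReal_nonneg, ENNReal.ofReal_toReal hfin,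
    ENNReal.ofReal_toReal hfin']
  exact le_tsub_add

theorem entropy_comp {Ω Ω' : Type*} [MeasurableSpace Ω] [MeasurableSpace Ω'] {P : Measure Ω}
    {P' : Measure Ω'} {φ : Ω → Ω'} (hφ : MeasurePreserving φ P P') {X : Ω' → ℝ}
    (hX : Measurable X) : entropy P (fun ω => X (φ ω)) = entropy P' X := by
  have hm : ∫ ω, X (φ ω) ∂P = ∫ ω, X ω ∂P' := by
    rw [← hφ.map_eq, integral_map hφ.measurable.aemeasurable hX.aestronglyMeasurable]
  have h1 : Measurable fun ω => X ω * Real.log (X ω / ∫ ω', X ω' ∂P') :=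
    hX.mul (Real.measurable_log.comp (hX.div_const _))
  rw [entropy, entropy, hm, ← hφ.lintegral_comp h1.ennreal_ofReal]
  congr 1
  exact hφ.lintegral_comp h1.neg.ennreal_ofReal

theorem entropy_congr {Ω : Type*} [MeasurableSpace Ω] {P : Measure Ω} {X Y : Ω → ℝ}
    (h : X =ᵐ[P] Y) : entropy P X = entropy P Y := by
  rw [entropy, entropy, integral_congr_ae h]
  congr 1
  · exact lintegral_congr_ae (by filter_upwards [h] with ω hω; rw [hω])
  · exact lintegral_congr_ae (by filter_upwards [h] with ω hω; rw [hω])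

end Entropy

section LSI

variable {ι : Type*}

theorem avgOff_dependsOn {α : Type*} [MeasurableSpace α] {ν : Measure α} [IsProbabilityMeasure ν]
    (S : Set ι) (f : (ι → α) → ℝ) : DependsOn (avgOff ν S f) S := by
  intro x y h
  have : ∀ ω', mix S x ω' = mix S y ω' := fun ω' => funext fun i => by
    by_cases hi : i ∈ S
    · simp [mix_of_mem hi, h i hi]
    · simp [mix_of_notMem hi]
  simp only [avgOff, this]

theorem firstCoords_eq_coe (e : ℕ ≃ ι) (N : ℕ) :
    firstCoords e N = (((Finset.range N).map e.toEmbedding : Finset ι) : Set ι) := by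
  ext i
  simp only [firstCoords, Finset.coe_map, Set.mem_image, Finset.mem_coe, Finset.mem_range]
  exact ⟨fun h => ⟨e.symm i, h, by simp⟩, fun ⟨n, hn, h⟩ => by
    rw [← h]; simpa using hn⟩

theorem lintegral_sq_avgOff_le {α : Type*} [MeasurableSpace α] {ν : Measure α}
    [IsProbabilityMeasure ν] (S : Set ι) {f : (ι → α) → ℝ} (hf : Measurable f)
    (hf2 : MemLp f 2 (powerLaw ι ν)) :
    ∫⁻ ω, ENNReal.ofReal (avgOff ν S f ω ^ 2) ∂(powerLaw ι ν) ≤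
      ∫⁻ ω, ENNReal.ofReal (f ω ^ 2) ∂(powerLaw ι ν) := by
  rw [lintegral_ofReal_sq hf2, lintegral_ofReal_sq (memLp_avgOff hf hf2)]
  refine ENNReal.ofReal_le_ofReal ?_
  have h := variance_avgOff_le (S := S) hf hf2
  rw [variance_eq_sub hf2, variance_eq_sub (memLp_avgOff hf hf2),
    integral_congr_ae (avgOff_ae_eq_condExp hf (hf2.integrable one_le_two)),
    integral_condExp (coordAlgebra_le S)] at h
  simpa using h

variable [DecidableEq ι]

/-- The logarithmic Sobolev inequality for square integrable functions of countably many fair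
bits. It follows from the finite case by conditioning on finitely many bits: the entropy is
lower semicontinuous and conditioning does not increase the right-hand side. -/
theorem entropy_sq_le_tsum_flipAt (e : ℕ ≃ ι) {f : (ι → Bool) → ℝ} (hf : Measurable f)
    (hf2 : MemLp f 2 (powerLaw ι coin)) :
    entropy (powerLaw ι coin) (fun ω => f ω ^ 2) ≤
      ∑' i, ∫⁻ ω, ENNReal.ofReal ((f ω - f (flipAt i ω)) ^ 2) ∂(powerLaw ι coin) := by
  set P := powerLaw ι coin
  set S := ∑' i, ∫⁻ ω, ENNReal.ofReal ((f ω - f (flipAt i ω)) ^ 2) ∂P with hS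
  by_cases hST : S = ∞
  · simp [hST]
  set F : ℕ → (ι → Bool) → ℝ := fun N => avgOff coin (firstCoords e N) f with hF
  have hFm : ∀ N, Measurable (F N) := fun N => measurable_avgOff hf
  have hF2 : ∀ N, MemLp (F N) 2 P := fun N => memLp_avgOff hf hf2
  have hfi := hf2.integrable one_le_two
  -- almost sure convergence of the finite-dimensional approximations
  have hlim : ∀ᵐ ω ∂P, Tendsto (fun N => F N ω) atTop (𝓝 (f ω)) := by
    have h1 := tendsto_ae_condExp (μ := P) (ℱ := coordFiltration Bool e) f
    have h2 : P[f | ⨆ n, coordFiltration Bool e n] = f := by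
      rw [iSup_coordFiltration]
      exact condExp_of_stronglyMeasurable le_rfl hf.stronglyMeasurable hfi
    have h3 : ∀ᵐ ω ∂P, ∀ N, F N ω = (P[f | coordFiltration Bool e N]) ω :=
      ae_all_iff.2 fun N => avgOff_ae_eq_condExp hf hfi
    filter_upwards [h1, h3] with ω hω h3ω
    rw [h2] at hω
    exact hω.congr fun N => (h3ω N).symm
  -- the finite-dimensional inequality, uniformly in `N`
  have hfin : ∀ N, ∫ ω, F N ω ^ 2 * Real.log (F N ω ^ 2) ∂P ≤
      (∫ ω, F N ω ^ 2 ∂P) * Real.log (∫ ω, F N ω ^ 2 ∂P) + S.toReal := by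
    intro N
    have hd : DependsOn (F N) (((Finset.range N).map e.toEmbedding : Finset ι) : Set ι) := by
      rw [← firstCoords_eq_coe]; exact avgOff_dependsOn _ _
    have h1 := integral_mul_log_sub_le_of_dependsOn _ _ hd
    have h2 : ∑ i ∈ (Finset.range N).map e.toEmbedding,
        ∫ ω, (F N ω - F N (flipAt i ω)) ^ 2 ∂P ≤ S.toReal := by
      refine (ENNReal.ofReal_le_iff_le_toReal hST).1 ?_
      rw [ENNReal.ofReal_sum_of_nonneg fun i _ => integral_nonneg fun _ => sq_nonneg _]
      refine le_trans (Finset.sum_le_sum fun i _ => ?_) (ENNReal.sum_le_tsum _)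
      have hmp := measurePreserving_flipAt i
      have hfm : Measurable fun ω => f (flipAt i ω) := hf.comp hmp.measurable
      have hf2' : MemLp (fun ω => f (flipAt i ω)) 2 P := hf2.comp_measurePreserving hmp
      have hF2' : MemLp (fun ω => F N (flipAt i ω)) 2 P := (hF2 N).comp_measurePreserving hmp
      rw [← lintegral_ofReal_sq (f := fun ω => F N ω - F N (flipAt i ω)) ((hF2 N).sub hF2')]
      refine le_trans (le_of_eq ?_) (lintegral_sq_avgOff_le (firstCoords e N) (hf.sub hfm)
        (hf2.sub hf2'))
      refine lintegral_congr_ae ?_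
      filter_upwards [avgOff_sub_ae (S := firstCoords e N) hf hfm hfi
        (hf2'.integrable one_le_two)] with ω hω
      simp only [Pi.sub_apply] at hω
      change _ = ENNReal.ofReal (avgOff coin (firstCoords e N) (f - fun ω => f (flipAt i ω)) ω ^ 2)
      rw [hω]
      congr 3
      exact (avgOff_comp_update hf measurePreserving_not i ω).symm
    linarith
  -- convergence of the second moments
  have hE : Tendsto (fun N => ∫ ω, F N ω ^ 2 ∂P) atTop (𝓝 (∫ ω, f ω ^ 2 ∂P)) := by
    have h1 : Tendsto (fun N => ∫⁻ ω, ENNReal.ofReal (F N ω ^ 2) ∂P) atTop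
        (𝓝 (∫⁻ ω, ENNReal.ofReal (f ω ^ 2) ∂P)) := by
      refine tendsto_of_le_liminf_of_limsup_le ?_ ?_
      · refine le_trans (le_of_eq (lintegral_congr_ae ?_)) (lintegral_liminf_le
          fun N => ((hFm N).pow_const 2).ennreal_ofReal)
        filter_upwards [hlim] with ω hω
        exact ((ENNReal.tendsto_ofReal (hω.pow 2)).liminf_eq).symm
      · exact limsup_le_of_le (h := .of_forall fun N => lintegral_sq_avgOff_le _ hf hf2)
    simp only [lintegral_ofReal_sq (hF2 _), lintegral_ofReal_sq hf2] at h1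
    have h2 := (ENNReal.tendsto_toReal ENNReal.ofReal_ne_top).comp h1
    simpa only [Function.comp_def, ENNReal.toReal_ofReal (integral_nonneg fun _ => sq_nonneg _)]
      using h2
  -- passing to the limit by Fatou's lemma, after adding `1` to make the integrand nonnegative
  have hFatou : ∫⁻ ω, ENNReal.ofReal (f ω ^ 2 * Real.log (f ω ^ 2) + 1) ∂P ≤
      ENNReal.ofReal ((∫ ω, f ω ^ 2 ∂P) * Real.log (∫ ω, f ω ^ 2 ∂P) + S.toReal + 1) := by
    have hψ : Continuous fun x : ℝ => x * Real.log x := Real.continuous_mul_log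
    calc ∫⁻ ω, ENNReal.ofReal (f ω ^ 2 * Real.log (f ω ^ 2) + 1) ∂P
        = ∫⁻ ω, liminf (fun N => ENNReal.ofReal (F N ω ^ 2 * Real.log (F N ω ^ 2) + 1))
            atTop ∂P := by
          refine lintegral_congr_ae ?_
          filter_upwards [hlim] with ω hω
          exact ((ENNReal.tendsto_ofReal
            (((hψ.tendsto _).comp (hω.pow 2)).add_const 1)).liminf_eq).symm
      _ ≤ liminf (fun N => ∫⁻ ω, ENNReal.ofReal (F N ω ^ 2 * Real.log (F N ω ^ 2) + 1) ∂P) atTop :=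
          lintegral_liminf_le fun N =>
            ((hψ.measurable.comp ((hFm N).pow_const 2)).add_const 1).ennreal_ofReal
      _ ≤ liminf (fun N => ENNReal.ofReal
            ((∫ ω, F N ω ^ 2 ∂P) * Real.log (∫ ω, F N ω ^ 2 ∂P) + S.toReal + 1)) atTop := by
          refine liminf_le_liminf (.of_forall fun N => ?_)
          have hd : DependsOn (F N) (((Finset.range N).map e.toEmbedding : Finset ι) : Set ι) := by
            rw [← firstCoords_eq_coe]; exact avgOff_dependsOn _ _
          have hi : Integrable (fun ω => F N ω ^ 2 * Real.log (F N ω ^ 2)) P :=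
            DependsOn.integrable_of_finset (s := (Finset.range N).map e.toEmbedding)
              fun x y h => by simp only [hd h]
          have hi' : Integrable (fun ω => F N ω ^ 2 * Real.log (F N ω ^ 2) + 1) P :=
            hi.add (integrable_const 1)
          rw [← ofReal_integral_eq_lintegral_ofReal hi' (.of_forall fun ω => by
            have := neg_one_le_mul_log (sq_nonneg (F N ω)); simp only [Pi.zero_apply]; linarith),
            integral_add hi (integrable_const 1)]
          refine ENNReal.ofReal_le_ofReal ?_
          have := hfin N
          simp only [integral_const, probReal_univ, smul_eq_mul, mul_one]
          linarith
      _ = _ := (ENNReal.tendsto_ofReal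
            ((((hψ.tendsto _).comp hE).add_const _).add_const 1)).liminf_eq
  have hnn : ∀ ω, 0 ≤ f ω ^ 2 * Real.log (f ω ^ 2) + 1 := fun ω => by
    have := neg_one_le_mul_log (sq_nonneg (f ω)); linarith
  have hm1 : Measurable fun ω => f ω ^ 2 * Real.log (f ω ^ 2) + 1 :=
    (Real.continuous_mul_log.measurable.comp (hf.pow_const 2)).add_const 1
  have hi1 : Integrable (fun ω => f ω ^ 2 * Real.log (f ω ^ 2) + 1) P := by
    refine ⟨hm1.aestronglyMeasurable, ?_⟩
    rw [hasFiniteIntegral_iff_ofReal (.of_forall hnn)]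
    exact hFatou.trans_lt ENNReal.ofReal_lt_top
  have hi : Integrable (fun ω => f ω ^ 2 * Real.log (f ω ^ 2)) P := by
    refine (hi1.sub (integrable_const (1 : ℝ))).congr (.of_forall fun ω => ?_)
    simp only [Pi.sub_apply, add_sub_cancel_right]
  refine (entropy_le_ofReal hf2.integrable_sq hi).trans ?_
  refine ENNReal.ofReal_le_of_le_toReal ?_
  rw [← ofReal_integral_eq_lintegral_ofReal hi1 (.of_forall hnn), integral_add hi
    (integrable_const 1)] at hFatou
  have h0 := neg_one_le_mul_log (integral_nonneg (μ := P) fun ω => sq_nonneg (f ω))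
  have hS0 : 0 ≤ S.toReal := ENNReal.toReal_nonneg
  have := (ENNReal.ofReal_le_ofReal_iff (by linarith)).1 hFatou
  simp only [integral_const, probReal_univ, smul_eq_mul, mul_one] at this
  linarith

end LSI

/-! ### Martingale increments and the energy of the encoding bits -/

section Blocks

variable {κ α : Type*} [MeasurableSpace α] {ν : Measure α} [IsProbabilityMeasure ν]

theorem measurePreserving_comp_left {α' : Type*} [MeasurableSpace α'] {ν' : Measure α'}
    [IsProbabilityMeasure ν'] {q : α' → α} (hq : MeasurePreserving q ν' ν) :
    MeasurePreserving (fun (β : κ → α') b => q (β b)) (powerLaw κ ν') (powerLaw κ ν) := by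
  refine ⟨measurable_pi_lambda _ fun b => hq.measurable.comp (measurable_pi_apply b), ?_⟩
  rw [Measure.infinitePi_map_pi _ fun _ => hq.measurable]
  congr 1
  exact funext fun _ => hq.map_eq

theorem avgOff_comp_left {α' : Type*} [MeasurableSpace α'] {ν' : Measure α'}
    [IsProbabilityMeasure ν'] {q : α' → α} (hq : MeasurePreserving q ν' ν) (S : Set κ)
    {f : (κ → α) → ℝ} (hf : Measurable f) (β : κ → α') :
    avgOff ν' S (fun β => f fun b => q (β b)) β = avgOff ν S f fun b => q (β b) := by
  have h := measurePreserving_comp_left (κ := κ) hq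
  have hm : Measurable fun ω' => f (mix S (fun b => q (β b)) ω') :=
    hf.comp ((measurable_mix S).comp (measurable_const.prodMk measurable_id))
  rw [avgOff, avgOff, ← h.map_eq, integral_map h.measurable.aemeasurable hm.aestronglyMeasurable]
  refine integral_congr_ae (.of_forall fun β' => congrArg f (funext fun b => ?_))
  by_cases hb : b ∈ S <;> simp [mix, hb]

variable [DecidableEq κ]

/-- The family of sequences of bits in which the bit `j` of the sequence `b` is flipped. -/
def flipBit (b : κ) (j : ℕ) (β : κ → ℕ → Bool) : κ → ℕ → Bool :=
  Function.update β b (flipAt j (β b))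

theorem measurePreserving_flipBit (b : κ) (j : ℕ) :
    MeasurePreserving (flipBit b j) (powerLaw κ (powerLaw ℕ coin))
      (powerLaw κ (powerLaw ℕ coin)) :=
  measurePreserving_update_self (measurePreserving_flipAt j) b

/-- The logarithmic Sobolev inequality for functions of countably many sequences of fair bits. -/
theorem entropy_sq_le_tsum_flipBit (e : ℕ ≃ κ) {f : (κ → ℕ → Bool) → ℝ} (hf : Measurable f)
    (hf2 : MemLp f 2 (powerLaw κ (powerLaw ℕ coin))) :
    entropy (powerLaw κ (powerLaw ℕ coin)) (fun β => f β ^ 2) ≤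
      ∑' b, ∑' j, ∫⁻ β, ENNReal.ofReal ((f β - f (flipBit b j β)) ^ 2)
        ∂(powerLaw κ (powerLaw ℕ coin)) := by
  have hc : MeasurePreserving (fun (ω : κ × ℕ → Bool) b j => ω (b, j))
      (powerLaw (κ × ℕ) coin) (powerLaw κ (powerLaw ℕ coin)) :=
    ⟨by fun_prop, Measure.infinitePi_map_curry (ι := κ) (κ := ℕ) fun _ _ => coin⟩
  have e' : ℕ ≃ κ × ℕ := Nat.pairEquiv.symm.trans (e.prodCongr (Equiv.refl ℕ))
  have h := entropy_sq_le_tsum_flipAt e' (hf.comp hc.measurable)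
    (hf2.comp_measurePreserving hc)
  rw [← entropy_comp hc (hf.pow_const 2)]
  refine h.trans (le_of_eq ?_)
  rw [ENNReal.tsum_prod']
  refine tsum_congr fun b => tsum_congr fun j => ?_
  have hm : Measurable fun β => ENNReal.ofReal ((f β - f (flipBit b j β)) ^ 2) :=
    ((hf.sub (hf.comp (measurePreserving_flipBit b j).measurable)).pow_const 2).ennreal_ofReal
  rw [← hc.lintegral_comp hm]
  refine lintegral_congr fun ω => ?_
  have : (fun b' j' => flipAt (b, j) ω (b', j')) = flipBit b j fun b' j' => ω (b', j') := by
    ext b' j'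
    by_cases hb : b' = b
    · subst hb
      by_cases hj : j' = j
      · subst hj; simp [flipAt, flipBit]
      · simp [flipAt, flipBit, hj]
    · simp [flipAt, flipBit, hb]
  simp only [Function.comp_apply, this]

/-- The entropies of the squared martingale increments add up to at most the energy of the
function with respect to flips of the bits that encode the independent variables. -/
theorem tsum_entropy_increment_le (e : ℕ ≃ κ) {q : (ℕ → Bool) → α}
    (hq : MeasurePreserving q (powerLaw ℕ coin) ν) {f : (κ → α) → ℝ} (hf : Measurable f)
    (hf2 : MemLp f 2 (powerLaw κ ν)) :
    ∑' k, entropy (powerLaw κ ν) (fun ω => (avgOff ν (firstCoords e (k + 1)) f ω -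
        avgOff ν (firstCoords e k) f ω) ^ 2) ≤
      ∑' b, ∑' j, ∫⁻ β : κ → ℕ → Bool, ENNReal.ofReal
        ((f (fun c => q (β c)) - f (fun c => q (flipBit b j β c))) ^ 2)
        ∂(powerLaw κ (powerLaw ℕ coin)) := by
  set P := powerLaw κ (powerLaw ℕ coin)
  have hΦ := measurePreserving_comp_left (κ := κ) hq
  set g : (κ → ℕ → Bool) → ℝ := fun β => f fun b => q (β b) with hg
  have hgm : Measurable g := hf.comp hΦ.measurable
  have hg2 : MemLp g 2 P := hf2.comp_measurePreserving hΦ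
  have hgi := hg2.integrable one_le_two
  -- conditioning on the first `k` weights, as an operator on functions of the bits
  set A : ℕ → ((κ → ℕ → Bool) → ℝ) → (κ → ℕ → Bool) → ℝ :=
    fun k => avgOff (powerLaw ℕ coin) (firstCoords e k) with hA
  have h1 : ∀ k, entropy (powerLaw κ ν) (fun ω => (avgOff ν (firstCoords e (k + 1)) f ω -
        avgOff ν (firstCoords e k) f ω) ^ 2) ≤
      ∑' b, ∑' j, ∫⁻ β, ENNReal.ofReal
        ((A (k + 1) (g - g ∘ flipBit b j) β - A k (g - g ∘ flipBit b j) β) ^ 2) ∂P := by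
    intro k
    have hm : Measurable fun ω => (avgOff ν (firstCoords e (k + 1)) f ω -
        avgOff ν (firstCoords e k) f ω) ^ 2 :=
      ((measurable_avgOff hf).sub (measurable_avgOff hf)).pow_const 2
    rw [← entropy_comp hΦ hm]
    simp only [← avgOff_comp_left hq _ hf]
    refine (entropy_sq_le_tsum_flipBit e
      ((measurable_avgOff hgm).sub (measurable_avgOff hgm))
      ((memLp_avgOff hgm hg2).sub (memLp_avgOff hgm hg2))).trans (le_of_eq ?_)
    refine tsum_congr fun b => tsum_congr fun j => lintegral_congr_ae ?_
    have hmp := measurePreserving_flipBit b j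
    have hg2' : MemLp (g ∘ flipBit b j) 2 P := hg2.comp_measurePreserving hmp
    have hgm' : Measurable (g ∘ flipBit b j) := hgm.comp hmp.measurable
    have hc : ∀ k β, avgOff (powerLaw ℕ coin) (firstCoords e k) (g ∘ flipBit b j) β =
        avgOff (powerLaw ℕ coin) (firstCoords e k) g (flipBit b j β) :=
      fun k β => avgOff_comp_update hgm (measurePreserving_flipAt j) b β
    filter_upwards [avgOff_sub_ae (S := firstCoords e k) hgm hgm' hgi (hg2'.integrable one_le_two),
      avgOff_sub_ae (S := firstCoords e (k + 1)) hgm hgm' hgi (hg2'.integrable one_le_two)]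
      with β h0 h1
    simp only [hA, h0, h1, Pi.sub_apply, hc]
    congr 2
    ring
  calc _ ≤ ∑' k, ∑' b, ∑' j, ∫⁻ β, ENNReal.ofReal
        ((A (k + 1) (g - g ∘ flipBit b j) β - A k (g - g ∘ flipBit b j) β) ^ 2) ∂P :=
        ENNReal.tsum_le_tsum h1
    _ = ∑' b, ∑' j, ∑' k, ∫⁻ β, ENNReal.ofReal
        ((A (k + 1) (g - g ∘ flipBit b j) β - A k (g - g ∘ flipBit b j) β) ^ 2) ∂P := by
        rw [ENNReal.tsum_comm]
        exact tsum_congr fun b => ENNReal.tsum_comm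
    _ ≤ _ := ENNReal.tsum_le_tsum fun b => ENNReal.tsum_le_tsum fun j =>
        have hmp := measurePreserving_flipBit b j
        tsum_lintegral_sq_increment_le e (hgm.sub (hgm.comp hmp.measurable))
          (hg2.sub (hg2.comp_measurePreserving hmp))

end Blocks

section Increments

variable {d : ℕ} {μ : Measure ℝ≥0} [IsProbabilityMeasure μ]

theorem edgeFiltration_eq (e : ℕ ≃ Edge d) (k : ℕ) :
    edgeFiltration e k = coordAlgebra ℝ≥0 (firstCoords e k) := by
  rw [coordAlgebra_eq_iSup]
  change (⨆ j : ℕ, ⨆ _ : j < k, MeasurableSpace.comap (fun ω : Config d => ω (e j)) _) = _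
  refine le_antisymm (iSup₂_le fun j hj => ?_) (iSup₂_le fun b hb => ?_)
  · exact le_iSup₂_of_le (e j) (show e.symm (e j) < k by simpa using hj) le_rfl
  · exact le_iSup₂_of_le (e.symm b) hb (by simp)

theorem martingaleIncrement_ae_eq (e : ℕ ≃ Edge d) {f : Config d → ℝ} (hf : Measurable f)
    (hfi : Integrable f (weightLaw d μ)) (k : ℕ) :
    martingaleIncrement (weightLaw d μ) e f k =ᵐ[weightLaw d μ]
      fun ω => avgOff μ (firstCoords e (k + 1)) f ω - avgOff μ (firstCoords e k) f ω := by
  rw [martingaleIncrement, edgeFiltration_eq, edgeFiltration_eq]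
  exact ((avgOff_ae_eq_condExp hf hfi).sub (avgOff_ae_eq_condExp hf hfi)).symm

end Increments

/-! ### Encoding a weight by fair bits -/

section BitSum

/-- The number in `[0,1]` with binary digits `u 0, u 1, …`. -/
noncomputable def bitSum (u : ℕ → Bool) : ℝ := ∑' j, if u j then (1 / 2 : ℝ) ^ (j + 1) else 0

theorem summable_half_pow_succ : Summable fun j : ℕ => (1 / 2 : ℝ) ^ (j + 1) :=
  (summable_nat_add_iff 1).2 summable_geometric_two

theorem tsum_half_pow_succ : ∑' j : ℕ, (1 / 2 : ℝ) ^ (j + 1) = 1 := by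
  have h := summable_geometric_two.tsum_eq_zero_add
  rw [tsum_geometric_two] at h
  simp only [pow_zero] at h
  linarith

theorem summable_bitSum (u : ℕ → Bool) :
    Summable fun j => if u j then (1 / 2 : ℝ) ^ (j + 1) else 0 :=
  Summable.of_nonneg_of_le (fun j => by split_ifs <;> positivity)
    (fun j => by split_ifs <;> [exact le_rfl; positivity]) summable_half_pow_succ

theorem bitSum_nonneg (u : ℕ → Bool) : 0 ≤ bitSum u :=
  tsum_nonneg fun j => by split_ifs <;> positivity

theorem bitSum_le_one (u : ℕ → Bool) : bitSum u ≤ 1 := by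
  rw [← tsum_half_pow_succ]
  exact (summable_bitSum u).tsum_le_tsum (fun j => by split_ifs <;> [exact le_rfl; positivity])
    summable_half_pow_succ

theorem measurable_bitSum : Measurable bitSum := by
  unfold bitSum
  refine measurable_of_tendsto_metrizable (f := fun N (u : ℕ → Bool) => ∑ j ∈ Finset.range N,
    if u j then (1 / 2 : ℝ) ^ (j + 1) else 0) (fun N => ?_)
    (tendsto_pi_nhds.2 fun u => (summable_bitSum u).hasSum.tendsto_sum_nat)
  exact Finset.measurable_sum _ fun j _ =>
    (measurable_from_top (f := fun b : Bool => if b then (1 / 2 : ℝ) ^ (j + 1) else 0)).comp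
      (measurable_pi_apply j)

theorem bitSum_update_true (u : ℕ → Bool) (j : ℕ) :
    bitSum (Function.update u j true) =
      bitSum (Function.update u j false) + (1 / 2 : ℝ) ^ (j + 1) := by
  have h := (summable_bitSum (Function.update u j true)).hasSum.sub
    (summable_bitSum (Function.update u j false)).hasSum
  have h' : HasSum (fun i => (if Function.update u j true i then (1 / 2 : ℝ) ^ (i + 1) else 0) -
      if Function.update u j false i then (1 / 2 : ℝ) ^ (i + 1) else 0)
      ((1 / 2 : ℝ) ^ (j + 1)) := by
    convert hasSum_ite_eq j ((1 / 2 : ℝ) ^ (j + 1)) using 2 with i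
    by_cases hi : i = j
    · subst hi; simp
    · simp [hi]
  have := h.unique h'
  change bitSum _ - bitSum _ = _ at this
  linarith

theorem bitSum_eq_shift (u : ℕ → Bool) :
    bitSum u = ((if u 0 then 1 else 0) + bitSum fun n => u (n + 1)) / 2 := by
  rw [bitSum, (summable_bitSum u).tsum_eq_zero_add, bitSum, add_div, ← tsum_div_const]
  congr 1
  · split_ifs <;> norm_num
  · refine tsum_congr fun j => ?_
    split_ifs
    · rw [pow_succ _ (j + 1)]; ring
    · simp

theorem measurePreserving_shift :
    MeasurePreserving (fun (u : ℕ → Bool) n => u (n + 1)) (powerLaw ℕ coin)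
      (powerLaw ℕ coin) := by
  refine ⟨by fun_prop, Measure.eq_infinitePi _ fun s t ht => ?_⟩
  rw [Measure.map_apply (by fun_prop) (.pi s.countable_toSet fun i _ => ht i)]
  have : (fun (u : ℕ → Bool) n => u (n + 1)) ⁻¹' ((s : Set ℕ).pi t) =
      (((s.map (addRightEmbedding 1) : Finset ℕ) : Set ℕ).pi fun n => t (n - 1)) := by
    ext u
    simp
  rw [this, Measure.infinitePi_pi _ fun i _ => ht _]
  simp

/-- The truncation of a real number to `[0,1]`. -/
noncomputable def clamp (x : ℝ) : ℝ := max 0 (min x 1)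

theorem clamp_eq (x : ℝ) : clamp x = (clamp (2 * x) + clamp (2 * x - 1)) / 2 := by
  unfold clamp
  rcases le_total x 0 with h | h
  · rw [max_eq_left (min_le_of_left_le h), max_eq_left (min_le_of_left_le (by linarith)),
      max_eq_left (min_le_of_left_le (by linarith))]; simp
  rcases le_total x (1 / 2) with h' | h'
  · rw [min_eq_left (by linarith), min_eq_left (by linarith : 2 * x ≤ 1), max_eq_right h,
      max_eq_right (by linarith), max_eq_left (min_le_of_left_le (by linarith))]; ring
  rcases le_total x 1 with h'' | h''
  · rw [min_eq_left h'', min_eq_right (by linarith : 1 ≤ 2 * x),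
      min_eq_left (by linarith : 2 * x - 1 ≤ 1), max_eq_right h, max_eq_right (by linarith),
      max_eq_right (by linarith)]; ring
  · rw [min_eq_right h'', min_eq_right (by linarith), min_eq_right (by linarith)]; norm_num

theorem clamp_nonneg (x : ℝ) : 0 ≤ clamp x := le_max_left _ _

theorem clamp_le_one (x : ℝ) : clamp x ≤ 1 := max_le zero_le_one (min_le_right _ _)

/-- The self-similarity of the distribution function of `bitSum`: condition on the first digit. -/
theorem measureReal_bitSum_le_eq (x : ℝ) :
    (powerLaw ℕ coin).real {u | bitSum u ≤ x} =
      ((powerLaw ℕ coin).real {u | bitSum u ≤ 2 * x} +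
        (powerLaw ℕ coin).real {u | bitSum u ≤ 2 * x - 1}) / 2 := by
  have hs : ∀ y : ℝ, MeasurableSet {u | bitSum u ≤ y} := fun y =>
    measurableSet_le measurable_bitSum measurable_const
  have hind : ∀ y : ℝ, (powerLaw ℕ coin).real {u | bitSum u ≤ y} =
      ∫ u, Set.indicator (Set.Iic y) (fun _ => (1 : ℝ)) (bitSum u) ∂(powerLaw ℕ coin) := fun y => by
    rw [← integral_indicator_one (hs y)]
    rfl
  have hint : ∀ y : ℝ, Integrable (fun u => Set.indicator (Set.Iic y) (fun _ => (1 : ℝ)) (bitSum u))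
      (powerLaw ℕ coin) := fun y =>
    (integrable_const (1 : ℝ)).indicator (hs y)
  have hsh : ∀ y : ℝ, Integrable (fun u : ℕ → Bool => Set.indicator (Set.Iic y)
      (fun _ => (1 : ℝ)) (bitSum fun n => u (n + 1))) (powerLaw ℕ coin) := fun y =>
    measurePreserving_shift.integrable_comp_of_integrable (hint y)
  have hsi : ∀ y : ℝ, ∫ u, Set.indicator (Set.Iic y) (fun _ => (1 : ℝ)) (bitSum u)
      ∂(powerLaw ℕ coin) = ∫ u : ℕ → Bool, Set.indicator (Set.Iic y) (fun _ => (1 : ℝ))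
        (bitSum fun n => u (n + 1)) ∂(powerLaw ℕ coin) := fun y => by
    conv_lhs => rw [← measurePreserving_shift.map_eq]
    rw [integral_map measurePreserving_shift.measurable.aemeasurable (by
      rw [measurePreserving_shift.map_eq]; exact (hint y).aestronglyMeasurable)]
  rw [hind, hind, hind, integral_update_coin 0 (hint x), hsi (2 * x), hsi (2 * x - 1),
    ← integral_add (hsh _) (hsh _), ← integral_div]
  refine integral_congr_ae (.of_forall fun u => ?_)
  have h0 : bitSum (Function.update u 0 false) ≤ x ↔ bitSum (fun n => u (n + 1)) ≤ 2 * x := by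
    rw [bitSum_eq_shift]
    simp only [Function.update_self, Bool.false_eq_true, if_false, ne_eq, Nat.succ_ne_zero,
      not_false_eq_true, Function.update_of_ne]
    constructor <;> intro h <;> linarith
  have h1 : bitSum (Function.update u 0 true) ≤ x ↔ bitSum (fun n => u (n + 1)) ≤ 2 * x - 1 := by
    rw [bitSum_eq_shift]
    simp only [Function.update_self, if_true, ne_eq, Nat.succ_ne_zero,
      not_false_eq_true, Function.update_of_ne]
    constructor <;> intro h <;> linarith
  simp only [Set.indicator_apply, Set.mem_Iic, h0, h1]

theorem abs_measureReal_bitSum_sub_clamp_le (n : ℕ) (x : ℝ) :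
    |(powerLaw ℕ coin).real {u | bitSum u ≤ x} - clamp x| ≤ (1 / 2) ^ n := by
  induction n generalizing x with
  | zero =>
    rw [pow_zero, abs_le]
    have h1 : (powerLaw ℕ coin).real {u | bitSum u ≤ x} ≤ 1 := measureReal_le_one
    have h2 : 0 ≤ (powerLaw ℕ coin).real {u | bitSum u ≤ x} := measureReal_nonneg
    constructor <;> linarith [clamp_nonneg x, clamp_le_one x]
  | succ n ih =>
    rw [measureReal_bitSum_le_eq, clamp_eq, pow_succ]
    -- only one of the two terms contributes an error
    rcases lt_or_ge (2 * x) 1 with hx | hx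
    · have hG : (powerLaw ℕ coin).real {u | bitSum u ≤ 2 * x - 1} = 0 := by
        have : {u | bitSum u ≤ 2 * x - 1} = ∅ :=
          Set.eq_empty_of_forall_notMem fun u hu =>
            absurd (le_trans (bitSum_nonneg u) hu) (by linarith)
        rw [this, measureReal_empty]
      have hc : clamp (2 * x - 1) = 0 := max_eq_left (min_le_of_left_le (by linarith))
      have := ih (2 * x)
      rw [hG, hc, add_zero, add_zero, ← sub_div, abs_div, abs_two]
      linarith
    · have hG : (powerLaw ℕ coin).real {u | bitSum u ≤ 2 * x} = 1 := by
        have : {u | bitSum u ≤ 2 * x} = Set.univ :=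
          Set.eq_univ_of_forall fun u => (bitSum_le_one u).trans hx
        rw [this, probReal_univ]
      have hc : clamp (2 * x) = 1 := by
        rw [clamp, min_eq_right hx, max_eq_right zero_le_one]
      have := ih (2 * x - 1)
      rw [hG, hc, ← sub_div, add_sub_add_left_eq_sub, abs_div, abs_two]
      linarith

/-- A random number with independent fair binary digits is uniform: its distribution function is
a fixed point, as that of the uniform law, of a contraction. -/
theorem measurePreserving_bitSum :
    MeasurePreserving bitSum (powerLaw ℕ coin) (volume.restrict (Set.Icc (0 : ℝ) 1)) := by
  refine ⟨measurable_bitSum, ?_⟩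
  have : IsProbabilityMeasure ((powerLaw ℕ coin).map bitSum) :=
    Measure.isProbabilityMeasure_map measurable_bitSum.aemeasurable
  refine Measure.ext_of_Iic _ _ fun x => ?_
  have h : (powerLaw ℕ coin).real {u | bitSum u ≤ x} = clamp x := by
    refine eq_of_abs_sub_nonpos ?_
    exact ge_of_tendsto' (tendsto_pow_atTop_nhds_zero_of_lt_one (by norm_num) (by norm_num))
      fun n => abs_measureReal_bitSum_sub_clamp_le n x
  rw [Measure.map_apply measurable_bitSum measurableSet_Iic,
    Measure.restrict_apply measurableSet_Iic]
  have e : Set.Iic x ∩ Set.Icc (0 : ℝ) 1 = Set.Icc 0 (min x 1) := by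
    ext y; simp only [Set.mem_inter_iff, Set.mem_Iic, Set.mem_Icc, le_min_iff]; tauto
  rw [e, Real.volume_Icc, sub_zero]
  change (powerLaw ℕ coin) {u | bitSum u ≤ x} = _
  rw [← ofReal_measureReal, h, clamp]
  rcases le_total 0 (min x 1) with h0 | h0
  · rw [max_eq_right h0]
  · rw [max_eq_left h0, ENNReal.ofReal_zero, ENNReal.ofReal_of_nonpos h0]

end BitSum

section Quantile

variable (μ : Measure ℝ≥0)

/-- The quantile function of `μ`: the least `t` with `x ≤ μ [0, t]`, for `x < 1`. It is set to `0`
for `x ≥ 1`, where no such `t` need exist; a uniform variable is almost surely less than `1`. -/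
noncomputable def quantile (x : ℝ) : ℝ≥0 := if x < 1 then sInf {t | x ≤ distFun μ t} else 0

variable [IsProbabilityMeasure μ]

theorem distFun_le_one (t : ℝ≥0) : distFun μ t ≤ 1 := measureReal_le_one

theorem distFun_mono : Monotone (distFun μ) := fun _ _ h =>
  measureReal_mono (Set.Iic_subset_Iic.2 h)

theorem exists_lt_distFun {x : ℝ} (hx : x < 1) : ∃ t, x < distFun μ t := by
  have h : Tendsto (fun n : ℕ => μ (Set.Iic (n : ℝ≥0))) atTop
      (𝓝 (μ (⋃ n : ℕ, Set.Iic (n : ℝ≥0)))) :=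
    tendsto_measure_iUnion_atTop fun a b h => Set.Iic_subset_Iic.2 (by exact_mod_cast h)
  have hU : (⋃ n : ℕ, Set.Iic (n : ℝ≥0)) = Set.univ :=
    Set.eq_univ_of_forall fun t => Set.mem_iUnion.2 (exists_nat_ge t)
  rw [hU, measure_univ] at h
  have h' := (ENNReal.tendsto_toReal ENNReal.one_ne_top).comp h
  obtain ⟨n, hn⟩ := (h'.eventually_const_lt (by simpa using hx)).exists
  exact ⟨n, hn⟩

theorem quantile_le_iff {x : ℝ} (hx : x < 1) {t : ℝ≥0} :
    quantile μ x ≤ t ↔ x ≤ distFun μ t := by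
  rw [quantile, if_pos hx]
  have hne : {t | x ≤ distFun μ t}.Nonempty := (exists_lt_distFun μ hx).imp fun _ h => h.le
  refine ⟨fun h => ?_, fun h => csInf_le (OrderBot.bddBelow _) h⟩
  have hlt : ∀ n : ℕ, x ≤ distFun μ (t + 1 / ((n : ℝ≥0) + 1)) := fun n => by
    obtain ⟨s, hs, hst⟩ := exists_lt_of_csInf_lt hne
      (h.trans_lt (lt_add_of_pos_right t (by positivity : 0 < 1 / ((n : ℝ≥0) + 1))))
    exact le_trans hs (distFun_mono μ hst.le)
  have hI : (⋂ n : ℕ, Set.Iic (t + 1 / ((n : ℝ≥0) + 1))) = Set.Iic t := by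
    ext s
    simp only [Set.mem_iInter, Set.mem_Iic]
    refine ⟨fun h => ?_, fun h n => h.trans (le_add_of_nonneg_right (zero_le))⟩
    have : Tendsto (fun n : ℕ => t + 1 / ((n : ℝ≥0) + 1)) atTop (𝓝 (t + 0)) :=
      tendsto_const_nhds.add tendsto_one_div_add_atTop_nhds_zero_nat
    rw [add_zero] at this
    exact ge_of_tendsto' this h
  have h1 : Tendsto (fun n : ℕ => μ (Set.Iic (t + 1 / ((n : ℝ≥0) + 1)))) atTop
      (𝓝 (μ (⋂ n : ℕ, Set.Iic (t + 1 / ((n : ℝ≥0) + 1))))) := by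
    refine tendsto_measure_iInter_atTop (fun n => measurableSet_Iic.nullMeasurableSet)
      (fun a b hab => Set.Iic_subset_Iic.2 ?_) ⟨0, measure_ne_top _ _⟩
    gcongr
  rw [hI] at h1
  exact ge_of_tendsto' ((ENNReal.tendsto_toReal (measure_ne_top _ _)).comp h1) hlt

theorem le_distFun_quantile {x : ℝ} (hx : x < 1) : x ≤ distFun μ (quantile μ x) :=
  (quantile_le_iff μ hx).1 le_rfl

theorem quantile_monotoneOn : MonotoneOn (quantile μ) (Set.Iio 1) := fun _ hx _ hy hxy =>
  (quantile_le_iff μ hx).2 (hxy.trans (le_distFun_quantile μ hy))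

theorem measurable_quantile : Measurable (quantile μ) := by
  refine measurable_of_Iic fun t => ?_
  have : quantile μ ⁻¹' Set.Iic t = (Set.Iio 1 ∩ Set.Iic (distFun μ t)) ∪ Set.Ici 1 := by
    ext x
    simp only [Set.mem_preimage, Set.mem_Iic, Set.mem_union, Set.mem_inter_iff, Set.mem_Iio,
      Set.mem_Ici]
    rcases lt_or_ge x 1 with hx | hx
    · simp [quantile_le_iff μ hx, hx, hx.not_ge]
    · simp [quantile, hx, hx.not_gt]
  rw [this]
  exact (measurableSet_Iio.inter measurableSet_Iic).union measurableSet_Ici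

theorem ae_lt_one : ∀ᵐ x ∂(volume.restrict (Set.Icc (0 : ℝ) 1)), x < 1 := by
  have h1 : ∀ᵐ x ∂(volume.restrict (Set.Icc (0 : ℝ) 1)), x ≠ 1 :=
    ae_restrict_of_ae (Measure.ae_ne volume 1)
  filter_upwards [h1, ae_restrict_mem measurableSet_Icc] with x hx hx'
  exact lt_of_le_of_ne hx'.2 hx

theorem measurePreserving_quantile :
    MeasurePreserving (quantile μ) (volume.restrict (Set.Icc (0 : ℝ) 1)) μ := by
  have : IsProbabilityMeasure (volume.restrict (Set.Icc (0 : ℝ) 1)) := ⟨by simp⟩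
  have : IsProbabilityMeasure ((volume.restrict (Set.Icc (0 : ℝ) 1)).map (quantile μ)) :=
    Measure.isProbabilityMeasure_map (measurable_quantile μ).aemeasurable
  refine ⟨measurable_quantile μ, Measure.ext_of_Iic _ _ fun t => ?_⟩
  rw [Measure.map_apply (measurable_quantile μ) measurableSet_Iic]
  have h : (quantile μ ⁻¹' Set.Iic t : Set ℝ) =ᵐ[volume.restrict (Set.Icc (0 : ℝ) 1)]
      Set.Iic (distFun μ t) := by
    filter_upwards [ae_lt_one] with x hx
    exact propext (quantile_le_iff μ hx)
  rw [measure_congr h, Measure.restrict_apply measurableSet_Iic]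
  have e : Set.Iic (distFun μ t) ∩ Set.Icc (0 : ℝ) 1 = Set.Icc 0 (distFun μ t) := by
    ext y
    simp only [Set.mem_inter_iff, Set.mem_Iic, Set.mem_Icc]
    have := distFun_le_one μ t
    constructor
    · tauto
    · rintro ⟨h1, h2⟩; exact ⟨h2, h1, h2.trans this⟩
  rw [e, Real.volume_Icc, sub_zero, distFun, ofReal_measureReal]

/-- The encoding of a weight with law `μ` by fair bits. -/
noncomputable def bitWeight (u : ℕ → Bool) : ℝ≥0 := quantile μ (bitSum u)

theorem measurePreserving_bitWeight : MeasurePreserving (bitWeight μ) (powerLaw ℕ coin) μ :=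
  (measurePreserving_quantile μ).comp measurePreserving_bitSum

end Quantile

/-! ### The energy of a single weight -/

section OneWeight

/-- The energy, with respect to flips of the digit `j`, of a monotone function of a uniform
variable: the squared differences are at most the differences of the squares, which telescope. -/
theorem lintegral_sq_flip_le {H : ℝ → ℝ} (hm : Measurable H) (h0 : ∀ x, 0 ≤ H x)
    (hmono : MonotoneOn H (Set.Iio 1))
    (hint : IntervalIntegrable (fun x => H x ^ 2) volume 0 1) (j : ℕ) :
    ∫⁻ u, ENNReal.ofReal ((H (bitSum u) - H (bitSum (flipAt j u))) ^ 2) ∂(powerLaw ℕ coin) ≤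
      2 * ENNReal.ofReal ((∫ x in (1 - (1 / 2 : ℝ) ^ (j + 1))..1, H x ^ 2) -
        ∫ x in 0..(1 / 2 : ℝ) ^ (j + 1), H x ^ 2) := by
  set ε : ℝ := (1 / 2 : ℝ) ^ (j + 1) with hε
  have hε0 : 0 < ε := by positivity
  have hε1 : ε ≤ 1 := pow_le_one₀ (by norm_num) (by norm_num)
  -- if the digit `j` of `x` is `0`, then flipping it gives `x + ε`, which is at most `1`
  set φ : ℝ → ℝ≥0∞ :=
    (Set.Iic (1 - ε)).indicator fun x => ENNReal.ofReal ((H x - H (x + ε)) ^ 2) with hφ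
  have hφm : Measurable φ :=
    (((hm.sub (hm.comp (measurable_id.add_const ε))).pow_const 2).ennreal_ofReal).indicator
      measurableSet_Iic
  have hUm := measurable_bitSum
  have hfl : Measurable (flipAt j : (ℕ → Bool) → ℕ → Bool) :=
    (measurePreserving_flipAt j).measurable
  have step1 : ∫⁻ u, ENNReal.ofReal ((H (bitSum u) - H (bitSum (flipAt j u))) ^ 2)
      ∂(powerLaw ℕ coin) =
      ∫⁻ u, φ (bitSum (Function.update u j false)) ∂(powerLaw ℕ coin) := by
    have hm' : Measurable fun u =>
        ENNReal.ofReal ((H (bitSum u) - H (bitSum (flipAt j u))) ^ 2) :=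
      (((hm.comp hUm).sub (hm.comp (hUm.comp hfl))).pow_const 2).ennreal_ofReal
    rw [lintegral_update_coin j hm']
    refine lintegral_congr fun u => ?_
    have e1 : flipAt j (Function.update u j false) = Function.update u j true := by simp [flipAt]
    have e2 : flipAt j (Function.update u j true) = Function.update u j false := by simp [flipAt]
    have e3 : bitSum (Function.update u j false) ≤ 1 - ε := by
      have := bitSum_le_one (Function.update u j true)
      rw [bitSum_update_true] at this
      linarith
    rw [e1, e2, hφ, Set.indicator_of_mem (Set.mem_Iic.2 e3), bitSum_update_true,
      sub_sq_comm (H (bitSum (Function.update u j false) + _)), ← two_mul,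
      ← mul_assoc, ENNReal.inv_mul_cancel (by simp) (by simp), one_mul]
  have step2 : ∫⁻ u, φ (bitSum (Function.update u j false)) ∂(powerLaw ℕ coin) ≤
      2 * ∫⁻ u, φ (bitSum u) ∂(powerLaw ℕ coin) := by
    have hm' : Measurable fun u => φ (bitSum u) := hφm.comp hUm
    rw [lintegral_update_coin j hm', ← lintegral_const_mul' _ _ (by simp)]
    refine lintegral_mono fun u => ?_
    rw [← mul_assoc, ENNReal.mul_inv_cancel (by simp) (by simp), one_mul]
    exact le_self_add
  have hsub : ∀ a b : ℝ, 0 ≤ a → a ≤ 1 → 0 ≤ b → b ≤ 1 →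
      IntervalIntegrable (fun x => H x ^ 2) volume a b := fun a b ha ha1 hb hb1 =>
    hint.mono_set (by
      rw [Set.uIcc_of_le zero_le_one]
      exact Set.uIcc_subset_Icc ⟨ha, ha1⟩ ⟨hb, hb1⟩)
  have hs1 : IntervalIntegrable (fun x => H (x + ε) ^ 2) volume 0 (1 - ε) := by
    have := (hsub ε 1 hε0.le hε1 zero_le_one le_rfl).comp_add_right ε
    simpa using this
  have hs2 := hsub 0 (1 - ε) le_rfl zero_le_one (by linarith) (by linarith)
  have step3 : ∫⁻ u, φ (bitSum u) ∂(powerLaw ℕ coin) ≤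
      ENNReal.ofReal (∫ x in 0..(1 - ε), (H (x + ε) ^ 2 - H x ^ 2)) := by
    rw [measurePreserving_bitSum.lintegral_comp hφm, hφ, lintegral_indicator measurableSet_Iic,
      Measure.restrict_restrict measurableSet_Iic]
    have e : Set.Iic (1 - ε) ∩ Set.Icc (0 : ℝ) 1 = Set.Icc 0 (1 - ε) := by
      ext x; simp only [Set.mem_inter_iff, Set.mem_Iic, Set.mem_Icc]
      constructor
      · tauto
      · rintro ⟨h1, h2⟩; exact ⟨h2, h1, by linarith⟩
    have hmon : ∀ x, x < 1 - ε → H x ≤ H (x + ε) := fun x hx =>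
      hmono (show x < 1 by linarith) (show x + ε < 1 by linarith) (by linarith)
    have hae : ∀ᵐ x ∂(volume.restrict (Set.Ioc (0 : ℝ) (1 - ε))), x < 1 - ε := by
      filter_upwards [ae_restrict_of_ae (Measure.ae_ne volume (1 - ε)),
        ae_restrict_mem measurableSet_Ioc] with x hx hx'
      exact lt_of_le_of_ne hx'.2 hx
    rw [e, ← restrict_Ioc_eq_restrict_Icc, intervalIntegral.integral_of_le (by linarith),
      ofReal_integral_eq_lintegral_ofReal]
    · refine lintegral_mono_ae ?_
      filter_upwards [hae] with x hx
      refine ENNReal.ofReal_le_ofReal ?_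
      nlinarith [h0 x, hmon x hx]
    · exact (intervalIntegrable_iff_integrableOn_Ioc_of_le (by linarith)).1 (hs1.sub hs2)
    · filter_upwards [hae] with x hx
      have := hmon x hx
      simp only [Pi.zero_apply, sub_nonneg]
      exact pow_le_pow_left₀ (h0 x) this 2
  have step4 : ∫ x in 0..(1 - ε), (H (x + ε) ^ 2 - H x ^ 2) =
      (∫ x in (1 - ε)..1, H x ^ 2) - ∫ x in 0..ε, H x ^ 2 := by
    rw [intervalIntegral.integral_sub hs1 hs2,
      intervalIntegral.integral_comp_add_right (fun x => H x ^ 2) ε, zero_add, sub_add_cancel]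
    have a1 := intervalIntegral.integral_add_adjacent_intervals
      (hsub 0 ε le_rfl zero_le_one hε0.le hε1) (hsub ε 1 hε0.le hε1 zero_le_one le_rfl)
    have a2 := intervalIntegral.integral_add_adjacent_intervals hs2
      (hsub (1 - ε) 1 (by linarith) (by linarith) zero_le_one le_rfl)
    linarith
  rw [step1, ← step4]
  exact step2.trans (by gcongr)

/-- The sum of the influences of the binary digits on an initial interval of length `p`. -/
theorem sum_min_half_pow_le {p : ℝ} (hp0 : 0 < p) (hp1 : p ≤ 1) (N : ℕ) :
    ∑ j ∈ Finset.range N, min ((1 / 2 : ℝ) ^ (j + 1)) p ≤ 2 * (p * (1 - Real.log p)) := by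
  -- `J` is the first index with `2⁻ᴶ ≤ p`; below it the minimum is bounded by `p`, and from it on
  -- by the terms of a geometric series
  set J := ⌈Real.logb 2 p⁻¹⌉₊ with hJ
  have hlogp : Real.log p ≤ 0 := Real.log_nonpos hp0.le hp1
  have hlog2 : (1 / 2 : ℝ) < Real.log 2 := by linarith [Real.log_two_gt_d9]
  have hL : Real.logb 2 p⁻¹ ≤ 2 * -Real.log p := by
    rw [Real.logb, Real.log_inv, div_le_iff₀ (by linarith)]
    nlinarith
  have hL0 : 0 ≤ Real.logb 2 p⁻¹ := Real.logb_nonneg (by norm_num) ((one_le_inv₀ hp0).2 hp1)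
  have hJ1 : (J : ℝ) ≤ 2 * -Real.log p + 1 := by
    linarith [(Nat.ceil_lt_add_one hL0).le]
  have hJ2 : (1 / 2 : ℝ) ^ J ≤ p := by
    have h := Nat.le_ceil (Real.logb 2 p⁻¹)
    rw [Real.logb_le_iff_le_rpow (by norm_num) (by positivity), Real.rpow_natCast] at h
    rw [one_div, inv_pow]
    exact inv_le_of_inv_le₀ hp0 h
  have hpow : ∀ M : ℕ, ∑ j ∈ Finset.range M, min ((1 / 2 : ℝ) ^ (J + j + 1)) p ≤
      (1 / 2) ^ J - (1 / 2) ^ (J + M) := by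
    intro M
    induction M with
    | zero => simp
    | succ M ih =>
      rw [Finset.sum_range_succ]
      have : min ((1 / 2 : ℝ) ^ (J + M + 1)) p ≤ (1 / 2) ^ (J + M + 1) := min_le_left _ _
      rw [← add_assoc J M 1]
      rw [pow_succ] at this ⊢
      linarith
  have h1 : ∑ j ∈ Finset.range N, min ((1 / 2 : ℝ) ^ (j + 1)) p ≤
      ∑ j ∈ Finset.range (J + N), min ((1 / 2 : ℝ) ^ (j + 1)) p :=
    Finset.sum_le_sum_of_subset_of_nonneg (Finset.range_mono (Nat.le_add_left _ _))
      fun j _ _ => le_min (by positivity) hp0.le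
  rw [Finset.sum_range_add] at h1
  have h2 : ∑ j ∈ Finset.range J, min ((1 / 2 : ℝ) ^ (j + 1)) p ≤ J * p := by
    refine (Finset.sum_le_sum fun j _ => min_le_right _ _).trans ?_
    simp
  have h3 := hpow N
  have h4 : (0 : ℝ) < (1 / 2) ^ (J + N) := by positivity
  nlinarith

variable (μ : Measure ℝ≥0) [IsProbabilityMeasure μ]

/-- In terms of the quantile function this is the bound `x ≤ F (quantile x)` for `x > 0`. -/
theorem ae_distFun_pos : ∀ᵐ t ∂μ, 0 < distFun μ t := by
  have hm : MeasurableSet {t | 0 < distFun μ t} :=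
    measurableSet_lt measurable_const (distFun_mono μ).measurable
  suffices h : ∀ᵐ x ∂(volume.restrict (Set.Icc (0 : ℝ) 1)), 0 < distFun μ (quantile μ x) by
    have := (ae_map_iff (measurable_quantile μ).aemeasurable hm).2 h
    rwa [(measurePreserving_quantile μ).map_eq] at this
  have h1 : ∀ᵐ x ∂(volume.restrict (Set.Icc (0 : ℝ) 1)), x ≠ 0 :=
    ae_restrict_of_ae (Measure.ae_ne volume 0)
  filter_upwards [ae_lt_one, h1, ae_restrict_mem measurableSet_Icc] with x hx hx0 hx'
  exact (lt_of_le_of_ne hx'.1 (Ne.symm hx0)).trans_le (le_distFun_quantile μ hx)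

/-- The part of `E (1 - log F (t))` that comes from weights below the threshold `D`. -/
noncomputable def belowCost (D : ℝ≥0∞) : ℝ≥0∞ :=
  ∫⁻ t : ℝ≥0, {t : ℝ≥0 | (t : ℝ≥0∞) < D}.indicator
    (fun t => ENNReal.ofReal (1 - Real.log (distFun μ t))) t ∂μ

/-- Since `F (t) ≤ p = μ [0, D)` for `t < D`, the cost below `D` is at least `p (1 - log p)`. The
junk value `log 0 = 0` does not matter because `F (t) > 0` almost surely. -/
theorem le_belowCost (D : ℝ≥0∞) :
    ENNReal.ofReal (μ.real {t : ℝ≥0 | (t : ℝ≥0∞) < D} *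
      (1 - Real.log (μ.real {t : ℝ≥0 | (t : ℝ≥0∞) < D}))) ≤ belowCost μ D := by
  set A : Set ℝ≥0 := {t : ℝ≥0 | (t : ℝ≥0∞) < D} with hA
  have hAm : MeasurableSet A := measurableSet_lt measurable_coe_nnreal_ennreal measurable_const
  rw [ENNReal.ofReal_mul measureReal_nonneg, ofReal_measureReal, belowCost,
    mul_comm, ← lintegral_indicator_const hAm]
  refine lintegral_mono_ae ?_
  filter_upwards [ae_distFun_pos μ] with t ht
  refine Set.indicator_le_indicator' fun htA => ENNReal.ofReal_le_ofReal ?_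
  have : distFun μ t ≤ μ.real A :=
    measureReal_mono fun s hs => lt_of_le_of_lt (ENNReal.coe_le_coe.2 hs) htA
  linarith [Real.log_le_log ht this]

theorem integrable_sq_of_moment
    (hmoment : Integrable (fun t : ℝ≥0 => (t : ℝ) ^ 2 * max (Real.logb 2 (t : ℝ)) 0) μ) :
    Integrable (fun t : ℝ≥0 => (t : ℝ) ^ 2) μ := by
  refine (hmoment.add (integrable_const (4 : ℝ))).mono' (by fun_prop) (.of_forall fun t => ?_)
  rw [Real.norm_of_nonneg (sq_nonneg _), Pi.add_apply]
  rcases le_total (t : ℝ) 2 with h | h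
  · have : 0 ≤ (t : ℝ) ^ 2 * max (Real.logb 2 (t : ℝ)) 0 :=
      mul_nonneg (sq_nonneg _) (le_max_right _ _)
    nlinarith [t.coe_nonneg]
  · have h1 : 1 ≤ Real.logb 2 (t : ℝ) := by
      rw [Real.le_logb_iff_rpow_le (by norm_num) (by linarith)]
      simpa using h
    have : (t : ℝ) ^ 2 * 1 ≤ (t : ℝ) ^ 2 * max (Real.logb 2 (t : ℝ)) 0 :=
      mul_le_mul_of_nonneg_left (h1.trans (le_max_left _ _)) (sq_nonneg _)
    linarith

/-- There are at most `y + 1` natural numbers below `y`. -/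
theorem tsum_ite_lt_le (y : ℝ) (hy : 0 ≤ y) (c : ℝ≥0∞) :
    ∑' j : ℕ, (if (j : ℝ) < y then c else 0) ≤ ENNReal.ofReal (y + 1) * c := by
  rw [tsum_eq_sum (s := Finset.range ⌈y⌉₊) fun j hj => if_neg (by
    rw [Finset.mem_range, Nat.lt_ceil] at hj; exact hj)]
  refine (Finset.sum_le_card_nsmul _ _ c fun j _ => by split_ifs <;> simp).trans ?_
  rw [Finset.card_range, nsmul_eq_mul]
  gcongr
  rw [← ENNReal.ofReal_natCast]
  exact ENNReal.ofReal_le_ofReal (Nat.ceil_lt_add_one hy).le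

/-- The weights near the top of the distribution: this is where the logarithmic factor of the
moment assumption is used. -/
theorem tsum_lintegral_top_lt_top
    (hmoment : Integrable (fun t : ℝ≥0 => (t : ℝ) ^ 2 * max (Real.logb 2 (t : ℝ)) 0) μ) :
    ∑' j : ℕ, ∫⁻ x in Set.Icc (1 - (1 / 2 : ℝ) ^ (j + 1)) 1,
      ENNReal.ofReal ((quantile μ x : ℝ) ^ 2) < ∞ := by
  set L : ℝ≥0 → ℝ := fun t => max (Real.logb 2 (t : ℝ)) 0 with hL
  have hLm : Measurable L := (Real.measurable_log.comp measurable_coe_nnreal_real).div_const _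
    |>.max measurable_const
  set s : ℝ := (2 : ℝ) ^ (1 / 2 : ℝ) with hs
  have hs0 : 0 < s := by positivity
  have hs2 : s ^ 2 = 2 := by
    rw [hs, ← Real.rpow_natCast, ← Real.rpow_mul (by norm_num)]; norm_num
  have hs1 : s / 2 < 1 := by nlinarith
  -- split according to whether `t ^ 2 ≤ 2 ^ (j / 2)`
  have hpt : ∀ (j : ℕ) (t : ℝ≥0), ENNReal.ofReal ((t : ℝ) ^ 2) ≤ ENNReal.ofReal (s ^ j) +
      if (j : ℝ) < 4 * L t then ENNReal.ofReal ((t : ℝ) ^ 2) else 0 := by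
    intro j t
    split_ifs with h
    · exact le_add_self
    · rw [add_zero]
      refine ENNReal.ofReal_le_ofReal ?_
      rcases t.coe_nonneg.eq_or_lt with h0 | h0
      · rw [← h0, zero_pow two_ne_zero]; positivity
      have h1 : Real.logb 2 (t : ℝ) ≤ (j : ℝ) / 4 := by
        have : Real.logb 2 (t : ℝ) ≤ L t := le_max_left _ _
        linarith
      rw [Real.logb_le_iff_le_rpow (by norm_num) h0] at h1
      calc (t : ℝ) ^ 2 ≤ ((2 : ℝ) ^ ((j : ℝ) / 4)) ^ 2 := pow_le_pow_left₀ h0.le h1 2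
        _ = s ^ j := by
          rw [hs, ← Real.rpow_natCast, ← Real.rpow_natCast, ← Real.rpow_mul (by norm_num),
            ← Real.rpow_mul (by norm_num)]
          congr 1
          push_cast; ring
  have hQ := measurePreserving_quantile μ
  have hfm : ∀ j : ℕ, Measurable fun t : ℝ≥0 =>
      if (j : ℝ) < 4 * L t then ENNReal.ofReal ((t : ℝ) ^ 2) else 0 := fun j =>
    Measurable.ite (measurableSet_lt measurable_const (hLm.const_mul 4))
      ((measurable_coe_nnreal_real.pow_const 2).ennreal_ofReal) measurable_const
  have h1 : ∀ j : ℕ, ∫⁻ x in Set.Icc (1 - (1 / 2 : ℝ) ^ (j + 1)) 1,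
      ENNReal.ofReal ((quantile μ x : ℝ) ^ 2) ≤ ENNReal.ofReal ((s / 2) ^ j) +
        ∫⁻ t, (if (j : ℝ) < 4 * L t then ENNReal.ofReal ((t : ℝ) ^ 2) else 0) ∂μ := by
    intro j
    calc _ ≤ ∫⁻ x in Set.Icc (1 - (1 / 2 : ℝ) ^ (j + 1)) 1, (ENNReal.ofReal (s ^ j) +
          if (j : ℝ) < 4 * L (quantile μ x) then ENNReal.ofReal ((quantile μ x : ℝ) ^ 2) else 0) :=
          lintegral_mono fun x => hpt j _
      _ = ENNReal.ofReal (s ^ j) * ENNReal.ofReal ((1 / 2 : ℝ) ^ (j + 1)) +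
          ∫⁻ x in Set.Icc (1 - (1 / 2 : ℝ) ^ (j + 1)) 1, (if (j : ℝ) < 4 * L (quantile μ x) then
            ENNReal.ofReal ((quantile μ x : ℝ) ^ 2) else 0) := by
          rw [lintegral_add_left measurable_const, setLIntegral_const, Real.volume_Icc,
            sub_sub_cancel]
      _ ≤ _ := by
          refine add_le_add ?_ ?_
          · rw [← ENNReal.ofReal_mul (by positivity)]
            refine ENNReal.ofReal_le_ofReal ?_
            have e : s ^ j * (1 / 2 : ℝ) ^ (j + 1) = (s / 2) ^ j * (1 / 2) := by
              rw [pow_succ, div_eq_mul_one_div s 2, mul_pow]; ring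
            have : 0 < (s / 2) ^ j := by positivity
            linarith
          · rw [← hQ.lintegral_comp (hfm j)]
            refine lintegral_mono_set (Set.Icc_subset_Icc_left ?_)
            have : (1 / 2 : ℝ) ^ (j + 1) ≤ 1 := pow_le_one₀ (by norm_num) (by norm_num)
            linarith
  refine (ENNReal.tsum_le_tsum h1).trans_lt ?_
  rw [ENNReal.tsum_add, ← lintegral_tsum fun j => (hfm j).aemeasurable]
  refine ENNReal.add_lt_top.2 ⟨?_, ?_⟩
  · exact (summable_geometric_of_lt_one (by positivity) hs1).tsum_ofReal_lt_top
  · have hi : Integrable (fun t : ℝ≥0 => (4 * L t + 1) * (t : ℝ) ^ 2) μ := by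
      refine ((hmoment.const_mul 4).add (integrable_sq_of_moment μ hmoment)).congr
        (.of_forall fun t => ?_)
      simp only [Pi.add_apply, hL]; ring
    refine (lintegral_mono fun t => tsum_ite_lt_le (4 * L t)
      (mul_nonneg (by norm_num) (le_max_right _ _)) _).trans_lt ?_
    refine lt_of_eq_of_lt (lintegral_congr fun t => ?_) hi.lintegral_lt_top
    rw [ENNReal.ofReal_mul]
    have : 0 ≤ L t := le_max_right _ _
    positivity

/-- The passage time, up to an additive constant, as a function of the weight `t` of one edge:
the weight counts only until the detour, which costs `D` more, is better. -/
noncomputable def cutoff (D : ℝ≥0∞) (t : ℝ≥0) : ℝ := (min (t : ℝ≥0∞) D).toReal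

theorem cutoff_nonneg (D : ℝ≥0∞) (t : ℝ≥0) : 0 ≤ cutoff D t := ENNReal.toReal_nonneg

theorem cutoff_le (D : ℝ≥0∞) (t : ℝ≥0) : cutoff D t ≤ t :=
  ENNReal.toReal_mono ENNReal.coe_ne_top (min_le_left _ _)

theorem cutoff_mono (D : ℝ≥0∞) : Monotone (cutoff D) := fun _ _ h =>
  ENNReal.toReal_mono (min_lt_of_left_lt ENNReal.coe_lt_top).ne
    (min_le_min_right _ (ENNReal.coe_le_coe.2 h))

theorem cutoff_le_toReal {D : ℝ≥0∞} (hD : D ≠ ∞) (t : ℝ≥0) : cutoff D t ≤ D.toReal :=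
  ENNReal.toReal_mono hD (min_le_right _ _)

theorem cutoff_of_le {D : ℝ≥0∞} {t : ℝ≥0} (h : D ≤ t) : cutoff D t = D.toReal := by
  rw [cutoff, min_eq_right h]

theorem intervalIntegrable_cutoff_quantile (h2 : Integrable (fun t : ℝ≥0 => (t : ℝ) ^ 2) μ)
    (D : ℝ≥0∞) : IntervalIntegrable (fun x => cutoff D (quantile μ x) ^ 2) volume 0 1 := by
  rw [intervalIntegrable_iff_integrableOn_Icc_of_le zero_le_one]
  have h := (measurePreserving_quantile μ).integrable_comp_of_integrable h2
  refine h.mono' (((cutoff_mono D).measurable.comp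
    (measurable_quantile μ)).pow_const 2).aestronglyMeasurable (.of_forall fun x => ?_)
  rw [Real.norm_of_nonneg (sq_nonneg _)]
  exact pow_le_pow_left₀ (cutoff_nonneg _ _) (cutoff_le _ _) 2

theorem lintegral_sq_flip_cutoff_le (h2 : Integrable (fun t : ℝ≥0 => (t : ℝ) ^ 2) μ)
    (D : ℝ≥0∞) (j : ℕ) :
    ∫⁻ u, ENNReal.ofReal ((cutoff D (bitWeight μ u) - cutoff D (bitWeight μ (flipAt j u))) ^ 2)
        ∂(powerLaw ℕ coin) ≤
      2 * ENNReal.ofReal ((∫ x in (1 - (1 / 2 : ℝ) ^ (j + 1))..1, cutoff D (quantile μ x) ^ 2) -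
        ∫ x in 0..(1 / 2 : ℝ) ^ (j + 1), cutoff D (quantile μ x) ^ 2) :=
  lintegral_sq_flip_le ((cutoff_mono D).measurable.comp (measurable_quantile μ))
    (fun _ => cutoff_nonneg _ _) ((cutoff_mono D).comp_monotoneOn (quantile_monotoneOn μ))
    (intervalIntegrable_cutoff_quantile μ h2 D) j

/-- A bound that does not depend on `D`, useful when `D` is large. -/
theorem lintegral_sq_flip_cutoff_le_top (h2 : Integrable (fun t : ℝ≥0 => (t : ℝ) ^ 2) μ)
    (D : ℝ≥0∞) (j : ℕ) :
    ∫⁻ u, ENNReal.ofReal ((cutoff D (bitWeight μ u) - cutoff D (bitWeight μ (flipAt j u))) ^ 2)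
        ∂(powerLaw ℕ coin) ≤
      2 * ∫⁻ x in Set.Icc (1 - (1 / 2 : ℝ) ^ (j + 1)) 1,
        ENNReal.ofReal ((quantile μ x : ℝ) ^ 2) := by
  refine (lintegral_sq_flip_cutoff_le μ h2 D j).trans ?_
  gcongr
  set ε : ℝ := (1 / 2 : ℝ) ^ (j + 1) with hε
  have hε0 : 0 < ε := by positivity
  have hε1 : ε ≤ 1 := pow_le_one₀ (by norm_num) (by norm_num)
  have hint : IntervalIntegrable (fun x => cutoff D (quantile μ x) ^ 2) volume (1 - ε) 1 :=
    (intervalIntegrable_cutoff_quantile μ h2 D).mono_set (by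
      rw [Set.uIcc_of_le zero_le_one]
      exact Set.uIcc_subset_Icc ⟨by linarith, by linarith⟩ ⟨zero_le_one, le_rfl⟩)
  calc _ ≤ ENNReal.ofReal (∫ x in (1 - ε)..1, cutoff D (quantile μ x) ^ 2) :=
        ENNReal.ofReal_le_ofReal (sub_le_self _
          (intervalIntegral.integral_nonneg hε0.le fun _ _ => sq_nonneg _))
    _ = ∫⁻ x in Set.Ioc (1 - ε) 1, ENNReal.ofReal (cutoff D (quantile μ x) ^ 2) := by
        rw [intervalIntegral.integral_of_le (by linarith), ofReal_integral_eq_lintegral_ofReal]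
        · exact (intervalIntegrable_iff_integrableOn_Ioc_of_le (by linarith)).1 hint
        · exact .of_forall fun _ => sq_nonneg _
    _ ≤ _ := by
        rw [restrict_Ioc_eq_restrict_Icc]
        exact lintegral_mono fun x => ENNReal.ofReal_le_ofReal
          (pow_le_pow_left₀ (cutoff_nonneg _ _) (cutoff_le _ _) 2)

/-- A bound for small `D`: the truncated weight is equal to `D` off a set of probability
`μ [0, D)`, so that both terms of the telescoping difference are close to `D ^ 2 * 2⁻ʲ⁻¹`. -/
theorem lintegral_sq_flip_cutoff_le_min (h2 : Integrable (fun t : ℝ≥0 => (t : ℝ) ^ 2) μ)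
    {D : ℝ≥0∞} (hD : D ≠ ∞) (j : ℕ) :
    ∫⁻ u, ENNReal.ofReal ((cutoff D (bitWeight μ u) - cutoff D (bitWeight μ (flipAt j u))) ^ 2)
        ∂(powerLaw ℕ coin) ≤
      ENNReal.ofReal (2 * D.toReal ^ 2 *
        min ((1 / 2 : ℝ) ^ (j + 1)) (μ.real {t : ℝ≥0 | (t : ℝ≥0∞) < D})) := by
  refine (lintegral_sq_flip_cutoff_le μ h2 D j).trans ?_
  rw [mul_assoc, ENNReal.ofReal_mul two_pos.le, ENNReal.ofReal_ofNat]
  gcongr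
  set ε : ℝ := (1 / 2 : ℝ) ^ (j + 1) with hε
  have hε0 : 0 < ε := by positivity
  have hε1 : ε ≤ 1 := pow_le_one₀ (by norm_num) (by norm_num)
  set p := μ.real {t : ℝ≥0 | (t : ℝ≥0∞) < D}
  have hint := intervalIntegrable_cutoff_quantile μ h2 D
  have hint1 : IntervalIntegrable (fun x => cutoff D (quantile μ x) ^ 2) volume (1 - ε) 1 :=
    hint.mono_set (by
      rw [Set.uIcc_of_le zero_le_one]
      exact Set.uIcc_subset_Icc ⟨by linarith, by linarith⟩ ⟨zero_le_one, le_rfl⟩)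
  have hint0 : IntervalIntegrable (fun x => cutoff D (quantile μ x) ^ 2) volume 0 ε :=
    hint.mono_set (by
      rw [Set.uIcc_of_le zero_le_one]
      exact Set.uIcc_subset_Icc ⟨le_rfl, zero_le_one⟩ ⟨hε0.le, hε1⟩)
  have htop : ∫ x in (1 - ε)..1, cutoff D (quantile μ x) ^ 2 ≤ D.toReal ^ 2 * ε := by
    have := intervalIntegral.integral_mono_on (by linarith) hint1
      (intervalIntegrable_const (c := D.toReal ^ 2)) fun x _ =>
        pow_le_pow_left₀ (cutoff_nonneg _ _) (cutoff_le_toReal hD (quantile μ x)) 2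
    rw [intervalIntegral.integral_const, sub_sub_cancel, smul_eq_mul] at this
    linarith
  set A : Set ℝ := {x | (quantile μ x : ℝ≥0∞) < D} with hA
  have hAm : MeasurableSet A :=
    measurableSet_lt (measurable_coe_nnreal_ennreal.comp (measurable_quantile μ)) measurable_const
  have hbot : D.toReal ^ 2 * ε - ∫ x in 0..ε, cutoff D (quantile μ x) ^ 2 ≤
      D.toReal ^ 2 * (volume.restrict (Set.Ioc 0 ε)).real A := by
    have e : D.toReal ^ 2 * ε - ∫ x in 0..ε, cutoff D (quantile μ x) ^ 2 =
        ∫ x in 0..ε, (D.toReal ^ 2 - cutoff D (quantile μ x) ^ 2) := by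
      rw [intervalIntegral.integral_sub intervalIntegrable_const hint0,
        intervalIntegral.integral_const, sub_zero, smul_eq_mul, mul_comm]
    rw [e, intervalIntegral.integral_of_le hε0.le]
    have hr : D.toReal ^ 2 * (volume.restrict (Set.Ioc 0 ε)).real A =
        ∫ x in Set.Ioc 0 ε, A.indicator (fun _ => D.toReal ^ 2) x := by
      rw [integral_indicator_const _ hAm, smul_eq_mul, mul_comm]
    rw [hr]
    refine integral_mono ?_ ((integrable_const _).indicator hAm) fun x => ?_
    · exact (intervalIntegrable_iff_integrableOn_Ioc_of_le hε0.le).1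
        (intervalIntegrable_const.sub hint0)
    · by_cases hx : x ∈ A
      · simp only [Set.indicator_of_mem hx]
        linarith [sq_nonneg (cutoff D (quantile μ x))]
      · simp only [Set.indicator_of_notMem hx]
        rw [cutoff_of_le (not_lt.1 hx), sub_self]
  have hAε : (volume.restrict (Set.Ioc 0 ε)).real A ≤ ε := by
    refine (measureReal_mono (Set.subset_univ A)).trans ?_
    simp [measureReal_def, hε0.le]
  have hAp : (volume.restrict (Set.Ioc 0 ε)).real A ≤ p := by
    have hm : MeasurableSet {t : ℝ≥0 | (t : ℝ≥0∞) < D} :=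
      measurableSet_lt measurable_coe_nnreal_ennreal measurable_const
    have : p = (volume.restrict (Set.Icc (0 : ℝ) 1)).real A := by
      change μ.real {t : ℝ≥0 | (t : ℝ≥0∞) < D} = _
      rw [measureReal_def, measureReal_def,
        ← (measurePreserving_quantile μ).measure_preimage hm.nullMeasurableSet]
      rfl
    rw [this, measureReal_def, measureReal_def]
    refine ENNReal.toReal_mono (measure_ne_top _ _) ?_
    exact Measure.restrict_mono (Set.Ioc_subset_Icc_self.trans (Set.Icc_subset_Icc_right hε1))
      le_rfl A
  have := mul_le_mul_of_nonneg_left (le_min hAε hAp) (sq_nonneg D.toReal)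
  linarith

/-- The energy of the passage time in the bits that encode the weight of a single edge is bounded
by the cost `1 - log F` of the weights for which the edge is used. -/
theorem exists_tsum_flip_cutoff_le
    (hmoment : Integrable (fun t : ℝ≥0 => (t : ℝ) ^ 2 * max (Real.logb 2 (t : ℝ)) 0) μ) :
    ∃ C : ℝ≥0, 0 < C ∧ ∀ D : ℝ≥0∞,
      ∑' j, ∫⁻ u, ENNReal.ofReal
        ((cutoff D (bitWeight μ u) - cutoff D (bitWeight μ (flipAt j u))) ^ 2) ∂(powerLaw ℕ coin) ≤
      C * belowCost μ D := by
  have h2 := integrable_sq_of_moment μ hmoment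
  obtain ⟨M, hM⟩ := exists_lt_distFun μ (x := 1 / 2) (by norm_num)
  set K := ∑' j : ℕ, ∫⁻ x in Set.Icc (1 - (1 / 2 : ℝ) ^ (j + 1)) 1,
      ENNReal.ofReal ((quantile μ x : ℝ) ^ 2) with hK
  have hKt : K ≠ ∞ := (tsum_lintegral_top_lt_top μ hmoment).ne
  refine ⟨4 * K.toNNReal + 4 * M ^ 2 + 1, by positivity, fun D => ?_⟩
  set p := μ.real {t : ℝ≥0 | (t : ℝ≥0∞) < D} with hp
  have hp1 : p ≤ 1 := measureReal_le_one
  have hcost := le_belowCost μ D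
  rw [← hp] at hcost
  rcases lt_or_ge (M : ℝ≥0∞) D with hMD | hMD
  · -- `D` exceeds a median: the left-hand side is bounded, the right-hand side is not small
    have hph : 1 / 2 ≤ p := hM.le.trans (measureReal_mono fun t ht =>
      lt_of_le_of_lt (ENNReal.coe_le_coe.2 ht) hMD)
    have hc : (2⁻¹ : ℝ≥0∞) ≤ belowCost μ D := by
      refine le_trans ?_ hcost
      rw [← ENNReal.ofReal_ofNat 2, ← ENNReal.ofReal_inv_of_pos two_pos]
      refine ENNReal.ofReal_le_ofReal ?_
      have := Real.log_nonpos (by linarith) hp1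
      nlinarith
    calc _ ≤ ∑' j : ℕ, 2 * ∫⁻ x in Set.Icc (1 - (1 / 2 : ℝ) ^ (j + 1)) 1,
            ENNReal.ofReal ((quantile μ x : ℝ) ^ 2) :=
          ENNReal.tsum_le_tsum fun j => lintegral_sq_flip_cutoff_le_top μ h2 D j
      _ = 4 * K * 2⁻¹ := by
          rw [ENNReal.tsum_mul_left, ← hK, mul_comm (4 : ℝ≥0∞), mul_assoc, mul_comm]
          congr 1
          rw [show (4 : ℝ≥0∞) = 2 * 2 by norm_num, mul_assoc,
            ENNReal.mul_inv_cancel (by simp) (by simp), mul_one]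
      _ ≤ _ := by
          refine mul_le_mul' ?_ hc
          push_cast
          rw [ENNReal.coe_toNNReal hKt, add_assoc]
          exact le_self_add
  · have hDt : D ≠ ∞ := (hMD.trans_lt ENNReal.coe_lt_top).ne
    have hDM : D.toReal ≤ M := ENNReal.toReal_mono ENNReal.coe_ne_top hMD
    have hsum : ∑' j : ℕ, ENNReal.ofReal (2 * D.toReal ^ 2 * min ((1 / 2 : ℝ) ^ (j + 1)) p) ≤
        ENNReal.ofReal (4 * (M : ℝ) ^ 2 * (p * (1 - Real.log p))) := by
      refine ENNReal.tsum_le_of_sum_range_le fun N => ?_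
      have hp0 : 0 ≤ p := measureReal_nonneg
      rw [← ENNReal.ofReal_sum_of_nonneg fun j _ => by positivity, ← Finset.mul_sum]
      refine ENNReal.ofReal_le_ofReal ?_
      rcases hp0.eq_or_lt with h0 | h0
      · rw [← h0]
        simp
      · have h1 := sum_min_half_pow_le h0 hp1 N
        have h3 : 0 ≤ ∑ j ∈ Finset.range N, min ((1 / 2 : ℝ) ^ (j + 1)) p :=
          Finset.sum_nonneg fun j _ => by positivity
        have h4 : D.toReal ^ 2 ≤ (M : ℝ) ^ 2 := pow_le_pow_left₀ ENNReal.toReal_nonneg hDM 2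
        calc _ ≤ 2 * (M : ℝ) ^ 2 * (2 * (p * (1 - Real.log p))) := by gcongr
          _ = _ := by ring
    calc _ ≤ _ := ENNReal.tsum_le_tsum fun j => lintegral_sq_flip_cutoff_le_min μ h2 hDt j
      _ ≤ _ := hsum
      _ = ((4 * M ^ 2 : ℝ≥0) : ℝ≥0∞) * ENNReal.ofReal (p * (1 - Real.log p)) := by
          rw [ENNReal.ofReal_mul (by positivity)]
          congr 1
          rw [← ENNReal.ofReal_coe_nnreal]
          norm_num
      _ ≤ _ := by
          refine mul_le_mul' (ENNReal.coe_le_coe.2 ?_) hcost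
          rw [add_assoc]
          exact le_add_of_nonneg_of_le zero_le (le_add_of_nonneg_right zero_le)

end OneWeight

/-! ### Passage times as functions of a single weight -/

section Paths

variable {d : ℕ} {x y : Fin d → ℤ}

/-- The edges of a walk, as a list of edges of the lattice. -/
def edgeList (γ : (lattice d).Walk x y) : List (Edge d) :=
  γ.darts.map fun a => ⟨a.edge, a.edge_mem⟩

theorem edgeList_map_val (γ : (lattice d).Walk x y) :
    (edgeList γ).map Subtype.val = γ.edges := by
  simp [edgeList, SimpleGraph.Walk.edges, Function.comp_def]

theorem mem_edgeList_iff {γ : (lattice d).Walk x y} {e : Edge d} :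
    e ∈ edgeList γ ↔ (e : Sym2 (Fin d → ℤ)) ∈ γ.edges := by
  rw [← edgeList_map_val, List.mem_map_of_injective Subtype.val_injective]

theorem pathTime_eq (ω : Config d) (γ : (lattice d).Walk x y) :
    pathTime ω γ = ((edgeList γ).map ω).sum := by
  simp [pathTime, edgeList, Function.comp_def]

theorem pathTime_bypass_le (ω : Config d) (γ : (lattice d).Walk x y) :
    pathTime ω γ.bypass ≤ pathTime ω γ :=
  (γ.darts_bypass_sublist_darts.map _).sum_le_sum fun _ _ => zero_le

theorem pathTime_update_of_notMem (ω : Config d) {γ : (lattice d).Walk x y} {e : Edge d}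
    (h : (e : Sym2 (Fin d → ℤ)) ∉ γ.edges) (t : ℝ≥0) :
    pathTime (Function.update ω e t) γ = pathTime ω γ := by
  rw [← mem_edgeList_iff] at h
  rw [pathTime_eq, pathTime_eq]
  congr 1
  refine List.map_congr_left fun a ha => Function.update_of_ne ?_ _ _
  rintro rfl
  exact h ha

theorem pathTime_update_of_mem (ω : Config d) {γ : (lattice d).Walk x y} (hγ : γ.IsPath)
    {e : Edge d} (h : (e : Sym2 (Fin d → ℤ)) ∈ γ.edges) (t : ℝ≥0) :
    pathTime (Function.update ω e t) γ = pathTime (Function.update ω e 0) γ + t := by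
  rw [← mem_edgeList_iff] at h
  have hn : (edgeList γ).Nodup := by
    refine List.Nodup.of_map Subtype.val ?_
    rw [edgeList_map_val]
    exact hγ.edges_nodup
  rw [pathTime_eq, pathTime_eq]
  generalize edgeList γ = l at h hn
  obtain ⟨l₁, l₂, rfl⟩ := List.append_of_mem h
  have h1 : e ∉ l₁ := fun h1 => (List.nodup_append.1 hn).2.2 e h1 e (by simp) rfl
  have h2 : e ∉ l₂ := (List.nodup_cons.1 (List.nodup_append.1 hn).2.1).1
  have hc : ∀ l : List (Edge d), e ∉ l →
      l.map (Function.update ω e t) = l.map (Function.update ω e 0) := fun l hl =>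
    List.map_congr_left fun a ha => by
      have : a ≠ e := fun h => hl (h ▸ ha)
      simp [this]
  simp only [List.map_append, List.map_cons, List.sum_append, List.sum_cons, hc l₁ h1, hc l₂ h2,
    Function.update_self, zero_add]
  ring

instance instCountableWalk : Countable ((lattice d).Walk x y) :=
  SimpleGraph.Walk.edges_injective.countable

theorem measurable_pathTime (γ : (lattice d).Walk x y) :
    Measurable fun ω : Config d => pathTime ω γ := by
  simp only [pathTime_eq]
  generalize edgeList γ = l
  induction l with
  | nil => simp
  | cons a l ih =>
    simp only [List.map_cons, List.sum_cons]
    exact (measurable_pi_apply a).add ih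

theorem passageTime_le (ω : Config d) (γ : (lattice d).Walk x y) :
    passageTime ω x y ≤ pathTime ω γ := ciInf_le (OrderBot.bddBelow _) γ

theorem measurable_passageTime (x y : Fin d → ℤ) :
    Measurable fun ω : Config d => passageTime ω x y := by
  rcases isEmpty_or_nonempty ((lattice d).Walk x y) with h | h
  · simp only [passageTime, iInf_of_isEmpty]
    exact measurable_const
  · exact Measurable.iInf measurable_pathTime

/-- The infimum of the passage times of the walks that avoid the edge `e`. -/
noncomputable def avoidTime (ω : Config d) (e : Edge d) (x y : Fin d → ℤ) : ℝ≥0∞ :=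
  ⨅ γ : (lattice d).Walk x y, ⨅ _ : (e : Sym2 (Fin d → ℤ)) ∉ γ.edges, (pathTime ω γ : ℝ≥0∞)

/-- The infimum of the passage times of the paths through the edge `e`, not counting the weight
of `e`. -/
noncomputable def throughTime (ω : Config d) (e : Edge d) (x y : Fin d → ℤ) : ℝ≥0∞ :=
  ⨅ γ : (lattice d).Walk x y, ⨅ _ : γ.IsPath ∧ (e : Sym2 (Fin d → ℤ)) ∈ γ.edges,
    (pathTime (Function.update ω e 0) γ : ℝ≥0∞)

/-- The additional cost of the best detour around the edge `e`: the edge is worth using as long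
as its weight is smaller than this. The cost is `∞` if every walk uses the edge, and `0` if no
path through the edge is shorter than the detour even without the weight of the edge. -/
noncomputable def detourCost (ω : Config d) (e : Edge d) (x y : Fin d → ℤ) : ℝ≥0∞ :=
  avoidTime ω e x y - throughTime ω e x y

theorem measurable_detourCost (e : Edge d) (x y : Fin d → ℤ) :
    Measurable fun ω : Config d => detourCost ω e x y := by
  have hu : Measurable fun ω : Config d => Function.update ω e (0 : ℝ≥0) := by
    refine measurable_pi_lambda _ fun b => ?_
    by_cases hb : b = e
    · subst hb; simp
    · simp only [Function.update_of_ne hb]; fun_prop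
  refine Measurable.sub ?_ ?_
  · exact Measurable.iInf fun γ => Measurable.iInf fun _ =>
      measurable_coe_nnreal_ennreal.comp (measurable_pathTime γ)
  · exact Measurable.iInf fun γ => Measurable.iInf fun _ =>
      measurable_coe_nnreal_ennreal.comp ((measurable_pathTime γ).comp hu)

theorem avoidTime_update (ω : Config d) (e : Edge d) (t : ℝ≥0) :
    avoidTime (Function.update ω e t) e x y = avoidTime ω e x y := by
  unfold avoidTime
  refine iInf_congr fun γ => iInf_congr fun h => ?_
  rw [pathTime_update_of_notMem ω h]

theorem throughTime_update (ω : Config d) (e : Edge d) (t : ℝ≥0) :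
    throughTime (Function.update ω e t) e x y = throughTime ω e x y := by
  simp only [throughTime, Function.update_idem]

theorem detourCost_update (ω : Config d) (e : Edge d) (t : ℝ≥0) :
    detourCost (Function.update ω e t) e x y = detourCost ω e x y := by
  rw [detourCost, detourCost, avoidTime_update, throughTime_update]

/-- A shortest walk uses the edge `e` at most once. -/
theorem coe_passageTime_eq_min [Nonempty ((lattice d).Walk x y)] (ω : Config d) (e : Edge d) :
    (passageTime ω x y : ℝ≥0∞) = min (throughTime ω e x y + ω e) (avoidTime ω e x y) := by
  refine le_antisymm (le_min ?_ ?_) ?_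
  · rw [throughTime, ENNReal.iInf_add]
    refine le_iInf fun γ => ?_
    rw [ENNReal.iInf_add]
    refine le_iInf fun h => ?_
    rw [← ENNReal.coe_add, ← pathTime_update_of_mem ω h.1 h.2, Function.update_eq_self]
    exact ENNReal.coe_le_coe.2 (passageTime_le ω γ)
  · exact le_iInf₂ fun γ _ => ENNReal.coe_le_coe.2 (passageTime_le ω γ)
  · rw [passageTime, ENNReal.coe_iInf]
    refine le_iInf fun γ => le_trans ?_ (ENNReal.coe_le_coe.2 (pathTime_bypass_le ω γ))
    by_cases h : (e : Sym2 (Fin d → ℤ)) ∈ γ.bypass.edges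
    · refine (min_le_left _ _).trans ?_
      have := pathTime_update_of_mem ω γ.bypass_isPath h (ω e)
      rw [Function.update_eq_self] at this
      rw [this, ENNReal.coe_add]
      gcongr
      exact iInf₂_le γ.bypass ⟨γ.bypass_isPath, h⟩
    · exact (min_le_right _ _).trans (iInf₂_le γ.bypass h)

/-- As a function of the weight of one edge, the passage time is a constant plus the minimum of
the weight and the cost of the detour. -/
theorem passageTime_update_eq [Nonempty ((lattice d).Walk x y)] (ω : Config d) (e : Edge d)
    (t : ℝ≥0) : (passageTime (Function.update ω e t) x y : ℝ) =
      (min (throughTime ω e x y) (avoidTime ω e x y)).toReal +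
        cutoff (detourCost ω e x y) t := by
  have h := coe_passageTime_eq_min (x := x) (y := y) (Function.update ω e t) e
  rw [avoidTime_update, throughTime_update, Function.update_self] at h
  set A := throughTime ω e x y
  set B := avoidTime ω e x y
  have hfin : min A B ≠ ∞ := by
    have hlt : min (A + t) B < ∞ := by rw [← h]; exact ENNReal.coe_lt_top
    rcases min_lt_iff.1 hlt with h1 | h1
    · exact (min_lt_of_left_lt ((ENNReal.add_lt_top.1 h1).1)).ne
    · exact (min_lt_of_right_lt h1).ne
  have key : min (A + t) B = min A B + min (t : ℝ≥0∞) (B - A) := by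
    rcases le_total A B with hAB | hAB
    · rw [min_eq_left hAB, ← min_add_add_left, add_tsub_cancel_of_le hAB]
    · rw [min_eq_right hAB, tsub_eq_zero_of_le hAB, min_eq_right (zero_le), add_zero,
        min_eq_right (hAB.trans le_self_add)]
  rw [key] at h
  rw [cutoff, ← ENNReal.toReal_add hfin (min_lt_of_left_lt ENNReal.coe_lt_top).ne]
  change _ = (min A B + min (t : ℝ≥0∞) (B - A)).toReal
  rw [← h, ENNReal.coe_toReal]

/-- No geodesic can avoid an edge whose weight is smaller than the cost of the detour. -/
theorem mem_geodesicEdges_of_lt [Nonempty ((lattice d).Walk x y)] {ω : Config d} {e : Edge d}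
    (h : (ω e : ℝ≥0∞) < detourCost ω e x y) : e ∈ geodesicEdges ω x y := by
  intro γ hγ
  by_contra hne
  have h1 : avoidTime ω e x y ≤ passageTime ω x y := by
    rw [← show pathTime ω γ = passageTime ω x y from hγ]
    exact iInf₂_le γ hne
  have h2 := lt_tsub_iff_left.1 h
  rw [coe_passageTime_eq_min ω e] at h1
  exact absurd (h1.trans (min_le_left _ _)) h2.not_ge

end Paths

section Translation

variable {d : ℕ}

/-- The translation by `z`, as an automorphism of the lattice. -/
def shiftIso (z : Fin d → ℤ) : lattice d ≃g lattice d where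
  toEquiv := Equiv.addLeft z
  map_rel_iff' := by simp [lattice]

variable {x y : Fin d → ℤ}

theorem pathTime_map (φ : lattice d ≃g lattice d) (ω : Config d) (γ : (lattice d).Walk x y) :
    pathTime ω (γ.map φ.toHom) = pathTime (fun e => ω (φ.mapEdgeSet e)) γ := by
  simp only [pathTime, SimpleGraph.Walk.darts_map, List.map_map]
  rfl

theorem passageTime_map_le [Nonempty ((lattice d).Walk x y)] (φ : lattice d ≃g lattice d)
    (ω : Config d) :
    passageTime ω (φ x) (φ y) ≤ passageTime (fun e => ω (φ.mapEdgeSet e)) x y :=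
  le_ciInf fun γ => by
    rw [← pathTime_map]
    exact passageTime_le ω (γ.map φ.toHom)

theorem passageTime_map [hne : Nonempty ((lattice d).Walk x y)] (φ : lattice d ≃g lattice d)
    (ω : Config d) :
    passageTime ω (φ x) (φ y) = passageTime (fun e => ω (φ.mapEdgeSet e)) x y := by
  refine le_antisymm (passageTime_map_le φ ω) ?_
  have : Nonempty ((lattice d).Walk (φ x) (φ y)) := hne.map fun γ => γ.map φ.toHom
  have h := passageTime_map_le (x := φ x) (y := φ y) φ.symm fun e => ω (φ.mapEdgeSet e)
  have e1 : (fun e => ω (φ.mapEdgeSet (φ.symm.mapEdgeSet e))) = ω :=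
    funext fun e => congrArg ω (φ.mapEdgeSet.apply_symm_apply e)
  simpa only [e1, RelIso.symm_apply_apply] using h

theorem mem_geodesicEdges_of_map [Nonempty ((lattice d).Walk x y)] (φ : lattice d ≃g lattice d)
    {ω : Config d} {e : Edge d} (h : φ.mapEdgeSet e ∈ geodesicEdges ω (φ x) (φ y)) :
    e ∈ geodesicEdges (fun e => ω (φ.mapEdgeSet e)) x y := by
  intro γ hγ
  have h1 := h (γ.map φ.toHom) (by
    change pathTime ω (γ.map φ.toHom) = passageTime ω (φ x) (φ y)
    rw [pathTime_map, passageTime_map]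
    exact hγ)
  rw [SimpleGraph.Walk.edges_map] at h1
  exact (List.mem_map_of_injective (Sym2.map.injective φ.injective)).1 h1

theorem nonempty_walk_axisPoint [NeZero d] (z : Fin d → ℤ) (n : ℕ) :
    Nonempty ((lattice d).Walk z (z + axisPoint d n)) := by
  induction n with
  | zero =>
    have : z + axisPoint d 0 = z := by simp [axisPoint]
    rw [this]
    exact ⟨.nil⟩
  | succ n ih =>
    obtain ⟨γ⟩ := ih
    have hadj : (lattice d).Adj (z + axisPoint d n) (z + axisPoint d (n + 1)) := by
      have : ∀ i, |(z + axisPoint d n) i - (z + axisPoint d (n + 1)) i| =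
          if i = 0 then (1 : ℤ) else 0 := by
        intro i
        by_cases hi : i = 0
        · subst hi; simp [axisPoint]
        · simp [axisPoint, hi]
      change ∑ i, _ = (1 : ℤ)
      simp only [this, Finset.sum_ite_eq', Finset.mem_univ, if_true]
    exact ⟨γ.concat hadj⟩

variable (μ : Measure ℝ≥0) [IsProbabilityMeasure μ]

/-- The expected cost of the edges on all geodesics is translation invariant. -/
theorem lintegral_geodesicCost_shift_le [Nonempty ((lattice d).Walk x y)]
    (φ : lattice d ≃g lattice d) (w : ℝ≥0 → ℝ≥0∞) :
    ∫⁻ ω, ∑' b : geodesicEdges ω (φ x) (φ y), w (ω (b : Edge d)) ∂(weightLaw d μ) ≤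
      ∫⁻ ω, ∑' b : geodesicEdges ω x y, w (ω (b : Edge d)) ∂(weightLaw d μ) := by
  set τ := φ.mapEdgeSet
  have hmp : MeasurePreserving (fun (ω : Config d) e => ω (τ e)) (weightLaw d μ)
      (weightLaw d μ) ∧ MeasurableEmbedding fun (ω : Config d) e => ω (τ e) := by
    have e : (fun (ω : Config d) e => ω (τ e)) =
        MeasurableEquiv.piCongrLeft (fun _ : Edge d => ℝ≥0) τ.symm := by
      ext ω b
      obtain ⟨a, rfl⟩ := τ.symm.surjective b
      rw [MeasurableEquiv.coe_piCongrLeft, Equiv.piCongrLeft_apply_apply, Equiv.apply_symm_apply]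
    rw [e]
    exact ⟨⟨MeasurableEquiv.measurable _,
      Measure.infinitePi_map_piCongrLeft (fun _ : Edge d => μ) τ.symm⟩,
      MeasurableEquiv.measurableEmbedding _⟩
  conv_rhs => rw [← hmp.1.lintegral_comp_emb hmp.2]
  refine lintegral_mono fun ω => ?_
  rw [tsum_subtype (geodesicEdges ω (φ x) (φ y)) fun b => w (ω b),
    tsum_subtype (geodesicEdges (fun e => ω (τ e)) x y) fun b => w (ω (τ b)), ← τ.tsum_eq]
  refine ENNReal.tsum_le_tsum fun e => ?_
  by_cases h : τ e ∈ geodesicEdges ω (φ x) (φ y)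
  · rw [Set.indicator_of_mem h, Set.indicator_of_mem (mem_geodesicEdges_of_map φ h)]
  · rw [Set.indicator_of_notMem h]
    exact zero_le

end Translation

/-! ### From the passage times to their average -/

section Energy

variable {d : ℕ} {μ : Measure ℝ≥0} [IsProbabilityMeasure μ]

theorem measurable_belowCost : Measurable (belowCost μ) := by
  have hF : Measurable fun t : ℝ≥0 => ENNReal.ofReal (1 - Real.log (distFun μ t)) :=
    (measurable_const.sub (Real.measurable_log.comp (distFun_mono μ).measurable)).ennreal_ofReal
  have : Measurable fun p : ℝ≥0∞ × ℝ≥0 => {t : ℝ≥0 | (t : ℝ≥0∞) < p.1}.indicator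
      (fun t => ENNReal.ofReal (1 - Real.log (distFun μ t))) p.2 :=
    Measurable.ite (p := fun p : ℝ≥0∞ × ℝ≥0 => (p.2 : ℝ≥0∞) < p.1)
      (measurableSet_lt (measurable_coe_nnreal_ennreal.comp measurable_snd) measurable_fst)
      (hF.comp measurable_snd) measurable_const
  exact this.lintegral_prod_right'

/-- The energy of the passage time with respect to flips of the bits that encode the weights is
bounded by the expected cost of the edges that lie on every geodesic. -/
theorem tsum_flipBit_passageTime_le {C : ℝ≥0}
    (hC : ∀ D : ℝ≥0∞, ∑' j, ∫⁻ u, ENNReal.ofReal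
      ((cutoff D (bitWeight μ u) - cutoff D (bitWeight μ (flipAt j u))) ^ 2) ∂(powerLaw ℕ coin) ≤
      C * belowCost μ D)
    (x y : Fin d → ℤ) [Nonempty ((lattice d).Walk x y)] :
    ∑' e : Edge d, ∑' j, ∫⁻ β : Edge d → ℕ → Bool, ENNReal.ofReal
        (((passageTime (fun c => bitWeight μ (β c)) x y : ℝ) -
          passageTime (fun c => bitWeight μ (flipBit e j β c)) x y) ^ 2)
        ∂(powerLaw (Edge d) (powerLaw ℕ coin)) ≤
      C * ∫⁻ ω, ∑' b : geodesicEdges ω x y,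
        ENNReal.ofReal (1 - Real.log (distFun μ (ω (b : Edge d)))) ∂(weightLaw d μ) := by
  set w : ℝ≥0 → ℝ≥0∞ := fun t => ENNReal.ofReal (1 - Real.log (distFun μ t)) with hw
  have hwm : Measurable w :=
    (measurable_const.sub (Real.measurable_log.comp (distFun_mono μ).measurable)).ennreal_ofReal
  have hq := measurePreserving_bitWeight μ
  have hΦ := measurePreserving_comp_left (κ := Edge d) hq
  -- a measurable lower bound for the contribution of `e` to the right-hand side
  set ψ : Edge d → Config d → ℝ≥0∞ := fun e ω =>
    {t : ℝ≥0 | (t : ℝ≥0∞) < detourCost ω e x y}.indicator w (ω e) with hψ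
  have hψm : ∀ e, Measurable (ψ e) := fun e =>
    Measurable.ite (p := fun ω : Config d => (ω e : ℝ≥0∞) < detourCost ω e x y)
      (measurableSet_lt (measurable_coe_nnreal_ennreal.comp (measurable_pi_apply e))
        (measurable_detourCost e x y)) (hwm.comp (measurable_pi_apply e)) measurable_const
  -- integrating out the weight of `e`
  have hψi : ∀ e, ∫⁻ ω, belowCost μ (detourCost ω e x y) ∂(weightLaw d μ) =
      ∫⁻ ω, ψ e ω ∂(weightLaw d μ) := by
    intro e
    have hu := measurePreserving_update μ e
    rw [weightLaw, ← hu.lintegral_comp (hψm e),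
      lintegral_prod (fun p : Config d × ℝ≥0 => ψ e (Function.update p.1 e p.2))
        ((hψm e).comp hu.measurable).aemeasurable]
    refine lintegral_congr fun ω => ?_
    simp only [hψ, detourCost_update, Function.update_self]
    rfl
  have hT : Measurable fun ω : Config d => (passageTime ω x y : ℝ) :=
    measurable_coe_nnreal_real.comp (measurable_passageTime x y)
  have hedge : ∀ e : Edge d, ∑' j, ∫⁻ β : Edge d → ℕ → Bool, ENNReal.ofReal
        (((passageTime (fun c => bitWeight μ (β c)) x y : ℝ) -
          passageTime (fun c => bitWeight μ (flipBit e j β c)) x y) ^ 2)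
        ∂(powerLaw (Edge d) (powerLaw ℕ coin)) ≤ C * ∫⁻ ω, ψ e ω ∂(weightLaw d μ) := by
    intro e
    have hu := measurePreserving_update (powerLaw ℕ coin) e
    set g : ℕ → (Edge d → ℕ → Bool) → ℝ≥0∞ := fun j β => ENNReal.ofReal
        (((passageTime (fun c => bitWeight μ (β c)) x y : ℝ) -
          passageTime (fun c => bitWeight μ (flipBit e j β c)) x y) ^ 2) with hg
    have hgm : ∀ j, Measurable (g j) := fun j =>
      (((hT.comp hΦ.measurable).sub (hT.comp (hΦ.measurable.comp
        (measurePreserving_flipBit e j).measurable))).pow_const 2).ennreal_ofReal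
    have hup : ∀ (β : Edge d → ℕ → Bool) (u : ℕ → Bool),
        (fun c => bitWeight μ (Function.update β e u c)) =
          Function.update (fun c => bitWeight μ (β c)) e (bitWeight μ u) := fun β u =>
      funext fun c => by
        by_cases hc : c = e
        · subst hc; simp
        · simp [hc]
    have hgu : ∀ j β u, g j (Function.update β e u) = ENNReal.ofReal
        ((cutoff (detourCost (fun c => bitWeight μ (β c)) e x y) (bitWeight μ u) -
          cutoff (detourCost (fun c => bitWeight μ (β c)) e x y)
            (bitWeight μ (flipAt j u))) ^ 2) := by
      intro j β u
      have : flipBit e j (Function.update β e u) = Function.update β e (flipAt j u) := by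
        simp [flipBit]
      simp only [hg, this, hup, passageTime_update_eq, add_sub_add_left_eq_sub]
    calc ∑' j, ∫⁻ β, g j β ∂(powerLaw (Edge d) (powerLaw ℕ coin))
        = ∑' j, ∫⁻ β, ∫⁻ u, g j (Function.update β e u) ∂(powerLaw ℕ coin)
            ∂(powerLaw (Edge d) (powerLaw ℕ coin)) := by
          refine tsum_congr fun j => ?_
          rw [← hu.lintegral_comp (hgm j), lintegral_prod
            (fun p : (Edge d → ℕ → Bool) × (ℕ → Bool) => g j (Function.update p.1 e p.2))
            ((hgm j).comp hu.measurable).aemeasurable]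
      _ = ∫⁻ β, ∑' j, ∫⁻ u, g j (Function.update β e u) ∂(powerLaw ℕ coin)
            ∂(powerLaw (Edge d) (powerLaw ℕ coin)) :=
          (lintegral_tsum fun j =>
            (((hgm j).comp hu.measurable).lintegral_prod_right').aemeasurable).symm
      _ ≤ ∫⁻ β, C * belowCost μ (detourCost (fun c => bitWeight μ (β c)) e x y)
            ∂(powerLaw (Edge d) (powerLaw ℕ coin)) :=
          lintegral_mono fun β => by
            simp only [hgu]
            exact hC _
      _ = C * ∫⁻ ω, belowCost μ (detourCost ω e x y) ∂(weightLaw d μ) := by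
          have hm : Measurable fun ω : Config d => belowCost μ (detourCost ω e x y) :=
            measurable_belowCost.comp (measurable_detourCost e x y)
          rw [lintegral_const_mul' _ _ ENNReal.coe_ne_top, weightLaw, ← hΦ.lintegral_comp hm]
      _ = _ := by rw [hψi]
  calc _ ≤ ∑' e, C * ∫⁻ ω, ψ e ω ∂(weightLaw d μ) := ENNReal.tsum_le_tsum hedge
    _ = C * ∫⁻ ω, ∑' e, ψ e ω ∂(weightLaw d μ) := by
        rw [ENNReal.tsum_mul_left, lintegral_tsum fun e => (hψm e).aemeasurable]
    _ ≤ _ := by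
        gcongr with ω
        rw [tsum_subtype (geodesicEdges ω x y) fun b => w (ω b)]
        refine ENNReal.tsum_le_tsum fun e => ?_
        by_cases h : (ω e : ℝ≥0∞) < detourCost ω e x y
        · rw [Set.indicator_of_mem (mem_geodesicEdges_of_lt h)]
          exact Set.indicator_le_self _ _ _
        · simp only [hψ]
          rw [Set.indicator_of_notMem (s := {t : ℝ≥0 | (t : ℝ≥0∞) < detourCost ω e x y}) h]
          exact zero_le

/-- The passage time is at most that of a fixed walk, a finite sum of weights. -/
theorem memLp_passageTime (h2 : Integrable (fun t : ℝ≥0 => (t : ℝ) ^ 2) μ) (x y : Fin d → ℤ) :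
    MemLp (fun ω : Config d => (passageTime ω x y : ℝ)) 2 (weightLaw d μ) := by
  have hm : Measurable fun ω : Config d => (passageTime ω x y : ℝ) :=
    measurable_coe_nnreal_real.comp (measurable_passageTime x y)
  rcases isEmpty_or_nonempty ((lattice d).Walk x y) with h | ⟨⟨γ⟩⟩
  · simp [passageTime, iInf_of_isEmpty, weightLaw]
  · have hid : MemLp (fun t : ℝ≥0 => (t : ℝ)) 2 μ :=
      (memLp_two_iff_integrable_sq measurable_coe_nnreal_real.aestronglyMeasurable).2 h2
    have hγ : MemLp (fun ω : Config d => (pathTime ω γ : ℝ)) 2 (weightLaw d μ) := by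
      simp only [pathTime_eq]
      generalize edgeList γ = l
      induction l with
      | nil => simp [weightLaw]
      | cons a l ih =>
        simp only [List.map_cons, List.sum_cons, NNReal.coe_add]
        exact (hid.comp_measurePreserving
          (measurePreserving_eval_infinitePi (fun _ : Edge d => μ) a)).add ih
    refine hγ.mono hm.aestronglyMeasurable (.of_forall fun ω => ?_)
    rw [Real.norm_of_nonneg (NNReal.coe_nonneg _), Real.norm_of_nonneg (NNReal.coe_nonneg _)]
    exact NNReal.coe_le_coe.2 (passageTime_le ω γ)

variable [NeZero d]

theorem measurable_averagedTime (n : ℕ) : Measurable (averagedTime d n) :=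
  (Finset.measurable_sum _ fun _ _ =>
    measurable_coe_nnreal_real.comp (measurable_passageTime _ _)).const_mul _

theorem memLp_averagedTime (h2 : Integrable (fun t : ℝ≥0 => (t : ℝ) ^ 2) μ) (n : ℕ) :
    MemLp (averagedTime d n) 2 (weightLaw d μ) :=
  (memLp_finsetSum _ fun _ _ => memLp_passageTime h2 _ _).const_mul _

/-- The averaged passage time varies at most as much, in mean square, as the passage times. -/
theorem ofReal_sq_averagedTime_sub_le (n : ℕ) (ω ω' : Config d) :
    ENNReal.ofReal ((averagedTime d n ω - averagedTime d n ω') ^ 2) ≤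
      ((ball d ⌈(n : ℝ) ^ (1 / 4 : ℝ)⌉₊).card : ℝ≥0∞)⁻¹ *
        ∑ z ∈ ball d ⌈(n : ℝ) ^ (1 / 4 : ℝ)⌉₊, ENNReal.ofReal
          (((passageTime ω z (z + axisPoint d n) : ℝ) -
            passageTime ω' z (z + axisPoint d n)) ^ 2) := by
  set B := ball d ⌈(n : ℝ) ^ (1 / 4 : ℝ)⌉₊ with hB
  have hB0 : 0 < (B.card : ℝ) := by
    have : B.Nonempty := ⟨0, mem_ball.2 (by simp)⟩
    exact_mod_cast this.card_pos
  have e : ((B.card : ℝ≥0∞))⁻¹ = ENNReal.ofReal ((B.card : ℝ)⁻¹) := by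
    rw [ENNReal.ofReal_inv_of_pos hB0, ENNReal.ofReal_natCast]
  rw [e, ← ENNReal.ofReal_sum_of_nonneg fun _ _ => sq_nonneg _,
    ← ENNReal.ofReal_mul (by positivity)]
  refine ENNReal.ofReal_le_ofReal ?_
  rw [averagedTime, averagedTime, ← mul_sub, ← Finset.sum_sub_distrib, mul_pow, sq (B.card : ℝ)⁻¹,
    mul_assoc]
  refine mul_le_mul_of_nonneg_left ?_ (by positivity)
  rw [inv_mul_le_iff₀ hB0]
  exact sq_sum_le_card_mul_sum_sq

theorem tsum_flipBit_averagedTime_le {C : ℝ≥0}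
    (hC : ∀ D : ℝ≥0∞, ∑' j, ∫⁻ u, ENNReal.ofReal
      ((cutoff D (bitWeight μ u) - cutoff D (bitWeight μ (flipAt j u))) ^ 2) ∂(powerLaw ℕ coin) ≤
      C * belowCost μ D) (n : ℕ) :
    ∑' e : Edge d, ∑' j, ∫⁻ β : Edge d → ℕ → Bool, ENNReal.ofReal
        ((averagedTime d n (fun c => bitWeight μ (β c)) -
          averagedTime d n (fun c => bitWeight μ (flipBit e j β c))) ^ 2)
        ∂(powerLaw (Edge d) (powerLaw ℕ coin)) ≤
      C * ∫⁻ ω, ∑' b : geodesicEdges ω 0 (axisPoint d n),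
        ENNReal.ofReal (1 - Real.log (distFun μ (ω (b : Edge d)))) ∂(weightLaw d μ) := by
  set R := ∫⁻ ω, ∑' b : geodesicEdges ω 0 (axisPoint d n),
        ENNReal.ofReal (1 - Real.log (distFun μ (ω (b : Edge d)))) ∂(weightLaw d μ) with hR
  set B := ball d ⌈(n : ℝ) ^ (1 / 4 : ℝ)⌉₊ with hB
  have hB0 : (B.card : ℝ≥0∞) ≠ 0 := by
    have : B.Nonempty := ⟨0, mem_ball.2 (by simp)⟩
    exact_mod_cast this.card_pos.ne'
  set g : (Fin d → ℤ) → Edge d → ℕ → (Edge d → ℕ → Bool) → ℝ≥0∞ := fun z e j β =>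
    ENNReal.ofReal (((passageTime (fun c => bitWeight μ (β c)) z (z + axisPoint d n) : ℝ) -
      passageTime (fun c => bitWeight μ (flipBit e j β c)) z (z + axisPoint d n)) ^ 2) with hg
  have hΦ := measurePreserving_comp_left (κ := Edge d) (measurePreserving_bitWeight μ)
  have hgm : ∀ z e j, Measurable (g z e j) := fun z e j => by
    have hT : Measurable fun ω : Config d => (passageTime ω z (z + axisPoint d n) : ℝ) :=
      measurable_coe_nnreal_real.comp (measurable_passageTime _ _)
    exact (((hT.comp hΦ.measurable).sub (hT.comp (hΦ.measurable.comp
      (measurePreserving_flipBit e j).measurable))).pow_const 2).ennreal_ofReal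
  have hz : ∀ z, ∑' e, ∑' j, ∫⁻ β, g z e j β ∂(powerLaw (Edge d) (powerLaw ℕ coin)) ≤ C * R := by
    intro z
    have h1 := nonempty_walk_axisPoint z n
    have h0 : Nonempty ((lattice d).Walk 0 (axisPoint d n)) := by
      simpa using nonempty_walk_axisPoint (0 : Fin d → ℤ) n
    refine (tsum_flipBit_passageTime_le hC z (z + axisPoint d n)).trans ?_
    gcongr
    have h := lintegral_geodesicCost_shift_le (x := 0) (y := axisPoint d n) μ (shiftIso z)
      fun t => ENNReal.ofReal (1 - Real.log (distFun μ t))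
    have e1 : shiftIso z 0 = z := add_zero z
    have e2 : shiftIso z (axisPoint d n) = z + axisPoint d n := rfl
    rwa [e1, e2] at h
  calc _ ≤ ∑' e, ∑' j, ∫⁻ β, (B.card : ℝ≥0∞)⁻¹ * ∑ z ∈ B, g z e j β
          ∂(powerLaw (Edge d) (powerLaw ℕ coin)) :=
        ENNReal.tsum_le_tsum fun e => ENNReal.tsum_le_tsum fun j =>
          lintegral_mono fun β => ofReal_sq_averagedTime_sub_le n _ _
    _ = (B.card : ℝ≥0∞)⁻¹ * ∑ z ∈ B, ∑' e, ∑' j, ∫⁻ β, g z e j β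
          ∂(powerLaw (Edge d) (powerLaw ℕ coin)) := by
        have h1 : ∀ e j, ∫⁻ β, (B.card : ℝ≥0∞)⁻¹ * ∑ z ∈ B, g z e j β
            ∂(powerLaw (Edge d) (powerLaw ℕ coin)) = (B.card : ℝ≥0∞)⁻¹ * ∑ z ∈ B,
              ∫⁻ β, g z e j β ∂(powerLaw (Edge d) (powerLaw ℕ coin)) := fun e j => by
          rw [lintegral_const_mul' _ _ (ENNReal.inv_ne_top.2 hB0),
            lintegral_finsetSum _ fun z _ => hgm z e j]
        simp only [h1, ENNReal.tsum_mul_left,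
          Summable.tsum_finsetSum fun _ _ => ENNReal.summable]
    _ ≤ (B.card : ℝ≥0∞)⁻¹ * ∑ z ∈ B, C * R := by
        gcongr with z _
        exact hz z
    _ = C * R := by
        rw [Finset.sum_const, nsmul_eq_mul, ← mul_assoc,
          ENNReal.inv_mul_cancel hB0 (ENNReal.natCast_ne_top _), one_mul]

end Energy

end FPP

theorem mainTheorem4 (d : ℕ) [NeZero d] (μ : Measure ℝ≥0) [IsProbabilityMeasure μ]
    (hzero : μ.real {0} < criticalProb d)
    (hmoment : Integrable (fun t : ℝ≥0 => (t : ℝ) ^ 2 * max (Real.logb 2 (t : ℝ)) 0) μ) :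
    (∀ n : ℕ, MemLp (averagedTime d n) 2 (weightLaw d μ)) ∧
    ∃ C : ℝ≥0, 0 < C ∧ ∀ (e : ℕ ≃ Edge d) (n : ℕ),
      ∑' i : ℕ, entropy (weightLaw d μ)
          (fun ω => |martingaleIncrement (weightLaw d μ) e (averagedTime d n) i ω| ^ 2) ≤
        C * ∫⁻ ω, ∑' b : geodesicEdges ω 0 (axisPoint d n),
          ENNReal.ofReal (1 - Real.log (distFun μ (ω (b : Edge d)))) ∂(weightLaw d μ) := by
  have h2 := integrable_sq_of_moment μ hmoment
  have hL2 : ∀ n, MemLp (averagedTime d n) 2 (weightLaw d μ) := memLp_averagedTime h2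
  obtain ⟨C, hC0, hC⟩ := exists_tsum_flip_cutoff_le μ hmoment
  refine ⟨hL2, C, hC0, fun e n => ?_⟩
  have : IsProbabilityMeasure (weightLaw d μ) := by unfold weightLaw; infer_instance
  calc _ = ∑' k, entropy (powerLaw (Edge d) μ) (fun ω =>
        (avgOff μ (firstCoords e (k + 1)) (averagedTime d n) ω -
          avgOff μ (firstCoords e k) (averagedTime d n) ω) ^ 2) := by
        refine tsum_congr fun k => entropy_congr ?_
        filter_upwards [martingaleIncrement_ae_eq e (measurable_averagedTime n)
          ((hL2 n).integrable one_le_two) k] with ω hω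
        rw [sq_abs, hω]
    _ ≤ _ := tsum_entropy_increment_le e (measurePreserving_bitWeight μ)
        (measurable_averagedTime n) (hL2 n)
    _ ≤ _ := tsum_flipBit_averagedTime_le hC n
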